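/- Consider an $N$-player game in which player $i$ chooses a matrix from $\mathcal X_i=\{X_i\in\mathbb C^{M_i\times M_i}\ \text{Hermitian}: X_i\succcurlyeq 0,\ \|X_i\|\le A_i\}$, where $A_i>0$ and $\|\cdot\|$ is the nuclear norm. Write $\mathcal X=\prod_i\mathcal X_i$, and identify a profile $X=(X_1,\dots,X_N)$ with the block-diagonal matrix $\mathrm{diag}(X_1,\dots,X_N)$. The utilities $u_i:\mathcal X\to\mathbb R$ are concave in $X_i$ (for fixed actions of the other players in $\mathcal X$) and twice continuously differentiable on $\mathcal X$. Let $V_i(X)=\nabla_{X_i}u_i(X)$, the Hermitian matrix with $\mathrm{tr}(V_i(X)H)=\mathrm{D}_{X_i}u_i(X)[H]$ for all Hermitian $H$. Let the Hessian of the game be the block matrix $D(X)=(D_{ij}(X))_{i,j}$ with $$D_{ij}(X)=\tfrac12\nabla_{X_i}\nabla_{X_j}u_j(X)+\tfrac12\bigl[\nabla_{X_j}\nabla_{X_i}u_i(X)\bigr]^\dagger,$$ and write $D(X)\prec0$ if its quadratic form is negative on all nonzero profiles of Hermitian matrices. Matrix exponential learning (MXL) with step-sizes $\gamma_n>0$ is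 the recursion, for $n=0,1,\dots$, $$X_i(n)=A_i\frac{\exp(Y_i(n))}{1+\|\exp(Y_i(n))\|},\qquad Y_i(n+1)=Y_i(n)+\gamma_n\bigl(V_i(X(n))+Z_i(n)\bigr),$$ with arbitrary (possibly random) Hermitian $Y_i(0)$. The noise $Z(n)$ is Hermitian and satisfies, for every $n$ and for a constant $\sigma>0$, $$\mathbb E[Z(n)\mid X(0),\dots,X(n)]=0,\qquad \mathbb E\bigl[\|Z(n)\|_*^p\mid X(0),\dots,X(n)\bigr]\le\frac{p!}{2}\,\sigma^p\quad(p=1,2,\dots),$$ where $\|Z\|_*$ is the largest absolute value of an eigenvalue of the block-diagonal matrix $Z$. Let $X^*\in\mathcal X$ be a Nash equilibrium of the game, that is, $u_i(X^*)\ge u_i(X_i;X^*_{-i})$ for all $i$ and all $X_i\in\mathcal X_i$, and suppose that $D(X^*)\prec0$. Then MXL converges locally to $X^*$ with arbitrarily high probability if the step-sizes are small enough: for every $\sigma>0$ and every $\varepsilon>0$ there are a neighborhood $U_\varepsilon$ of $X^*$ and a $\delta>0$ such that, for every sequence $\gamma_n>0$ with $\sum_n\gamma_n=\infty$, $\sum_n\gamma_n^{1+q}<\infty$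 for some $q\in(0,1)$, and $\sum_n\gamma_n^2\le\delta$, and for every run of MXL as above with step-sizes $\gamma_n$ and noise constant $\sigma$ such that $\mathbb P(X(0)\in U_\varepsilon)>0$, $$\mathbb P\bigl(X(n)\to X^*\,\big|\,X(0)\in U_\varepsilon\bigr)\ge1-\varepsilon .$$ -/

import Mathlib

open MeasureTheory ProbabilityTheory Filter Topology
open scoped Matrix.Norms.L2Operator ComplexOrder

noncomputable section

/-- The real vector space of `m × m` complex Hermitian matrices.  It carries the spectral norm
`‖A‖ = max_j |eig_j A|`, i.e. the dual of the nuclear norm. -/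
abbrev Herm (m : ℕ) : Type := selfAdjoint (Matrix (Fin m) (Fin m) ℂ)

/-- Profiles `(X₁, …, X_N)` of Hermitian matrices, identified with block-diagonal matrices.  The
norm is the maximum of the spectral norms of the blocks, i.e. the spectral norm of the
block-diagonal matrix. -/
abbrev Profile {N : ℕ} (M : Fin N → ℕ) : Type := (i : Fin N) → Herm (M i)

instance instFiniteDimensionalHerm (m : ℕ) : FiniteDimensional ℝ (Herm m) := by
  have h : FiniteDimensional ℝ (selfAdjoint.submodule ℝ (Matrix (Fin m) (Fin m) ℂ)) :=
    inferInstance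
  exact h

instance instCompleteSpaceHerm (m : ℕ) : CompleteSpace (Herm m) :=
  FiniteDimensional.complete ℝ (Herm m)

namespace Herm

variable {m : ℕ}

theorem isHermitian (X : Herm m) : (X : Matrix (Fin m) (Fin m) ℂ).IsHermitian :=
  selfAdjoint.mem_iff.1 X.2

/-- The nuclear (trace) norm `∑_j |eig_j X|`. -/
def nuclearNorm (X : Herm m) : ℝ := ∑ j, |X.isHermitian.eigenvalues j|

/-- The matrix exponential of a Hermitian matrix. -/
def exp (Y : Herm m) : Herm m :=
  ⟨NormedSpace.exp (Y : Matrix (Fin m) (Fin m) ℂ),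
    selfAdjoint.mem_iff.2 (Matrix.IsHermitian.exp Y.isHermitian)⟩

/-- The trace pairing `(A, B) ↦ tr (A B)` on Hermitian matrices (it is real-valued). -/
def tracePairing (m : ℕ) : Herm m →ₗ[ℝ] Module.Dual ℝ (Herm m) :=
  LinearMap.mk₂ ℝ
    (fun A B => ((A : Matrix (Fin m) (Fin m) ℂ) * (B : Matrix (Fin m) (Fin m) ℂ)).trace.re)
    (by intro A B C; simp [add_mul])
    (by intro c A B; simp)
    (by intro A B C; simp [mul_add])
    (by intro c A B; simp)

theorem tracePairing_injective (m : ℕ) : Function.Injective (tracePairing m) := by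
  rw [injective_iff_map_eq_zero]
  intro A hA
  have h : ((A : Matrix (Fin m) (Fin m) ℂ) * (A : Matrix (Fin m) (Fin m) ℂ)).trace.re = 0 :=
    LinearMap.congr_fun hA A
  have h2 : ((A : Matrix (Fin m) (Fin m) ℂ) * (A : Matrix (Fin m) (Fin m) ℂ)).trace.re
      = ∑ i, ∑ j, Complex.normSq ((A : Matrix (Fin m) (Fin m) ℂ) i j) := by
    simp only [Matrix.trace, Matrix.diag, Matrix.mul_apply, Complex.re_sum]
    refine Finset.sum_congr rfl fun i _ => Finset.sum_congr rfl fun j _ => ?_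
    have hs : star ((A : Matrix (Fin m) (Fin m) ℂ) i j) = (A : Matrix (Fin m) (Fin m) ℂ) j i :=
      A.isHermitian.apply j i
    rw [← hs, Complex.star_def, Complex.mul_conj]
    simp
  rw [h2] at h
  have h3 : ∀ i j, (A : Matrix (Fin m) (Fin m) ℂ) i j = 0 := by
    intro i j
    have h4 := (Finset.sum_eq_zero_iff_of_nonneg (fun i _ =>
      Finset.sum_nonneg fun j _ => Complex.normSq_nonneg _)).1 h i (Finset.mem_univ i)
    have h5 := (Finset.sum_eq_zero_iff_of_nonneg (fun j _ =>
      Complex.normSq_nonneg _)).1 h4 j (Finset.mem_univ j)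
    exact Complex.normSq_eq_zero.1 h5
  exact Subtype.ext (Matrix.ext h3)

/-- The Hermitian matrix `V` that represents a real linear functional `φ` on Hermitian matrices
through the trace, `φ H = tr (V H)`. -/
def ofDual (φ : Module.Dual ℝ (Herm m)) : Herm m :=
  ((tracePairing m).linearEquivOfInjective (tracePairing_injective m)
    (Subspace.dual_finrank_eq (K := ℝ) (V := Herm m)).symm).symm φ

theorem trace_ofDual_mul (φ : Module.Dual ℝ (Herm m)) (H : Herm m) :
    ((ofDual φ : Matrix (Fin m) (Fin m) ℂ) * (H : Matrix (Fin m) (Fin m) ℂ)).trace.re = φ H := by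
  have h : tracePairing m (ofDual φ) = φ :=
    ((tracePairing m).linearEquivOfInjective (tracePairing_injective m)
      (Subspace.dual_finrank_eq (K := ℝ) (V := Herm m)).symm).apply_symm_apply φ
  exact LinearMap.congr_fun h H

end Herm

/-- The action set `{X ≽ 0 : ‖X‖ ≤ A}`, where `‖X‖` is the nuclear norm. -/
def actionSet (m : ℕ) (A : ℝ) : Set (Herm m) :=
  {X | (X : Matrix (Fin m) (Fin m) ℂ).PosSemidef ∧ X.nuclearNorm ≤ A}

/-- The set of feasible action profiles. -/
def feasibleSet {N : ℕ} (M : Fin N → ℕ) (A : Fin N → ℝ) : Set (Profile M) :=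
  {X | ∀ i, X i ∈ actionSet (M i) (A i)}

/-- An `N`-player concave semidefinite game.  The utilities are functions on the feasible set (their
values elsewhere are never used), individually concave and twice continuously differentiable. -/
structure SemidefiniteGame (N : ℕ) where
  M : Fin N → ℕ
  A : Fin N → ℝ
  A_pos : ∀ i, 0 < A i
  u : Fin N → Profile M → ℝ
  concave : ∀ i, ∀ X ∈ feasibleSet M A,
    ConcaveOn ℝ (actionSet (M i) (A i)) fun Xi => u i (Function.update X i Xi)
  smooth : ∀ i, ContDiffOn ℝ 2 (u i) (feasibleSet M A)

namespace SemidefiniteGame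

variable {N : ℕ} (G : SemidefiniteGame N)

/-- The set of feasible action profiles of the game. -/
def feasible : Set (Profile G.M) := feasibleSet G.M G.A

/-- Nash equilibrium: a feasible profile from which no unilateral deviation is profitable. -/
def IsNash (Xs : Profile G.M) : Prop :=
  Xs ∈ G.feasible ∧ ∀ i, ∀ Xi ∈ actionSet (G.M i) (G.A i),
    G.u i (Function.update Xs i Xi) ≤ G.u i Xs

/-- The individual payoff gradient `V_i(X) = ∇_{X_i} u_i(X)`: the Hermitian matrix such that
`tr (V_i(X) H)` is the derivative of `u_i` at `X` in the direction `H` of the `i`-th block.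
Derivatives are taken within the feasible set, which has non-empty interior. -/
def V (X : Profile G.M) : Profile G.M := fun i =>
  Herm.ofDual ((fderivWithin ℝ (G.u i) G.feasible X : Profile G.M →ₗ[ℝ] ℝ) ∘ₗ
    LinearMap.single ℝ (fun j => Herm (G.M j)) i)

/-- `∇_{X_i} ∇_{X_j} u_k (X)` as a bilinear form in a direction `H` of the `i`-th block and a
direction `K` of the `j`-th block. -/
def mixedDeriv (k i j : Fin N) (X : Profile G.M) (H : Herm (G.M i)) (K : Herm (G.M j)) : ℝ :=
  fderivWithin ℝ (fderivWithin ℝ (G.u k) G.feasible) G.feasible X (Pi.single i H) (Pi.single j K)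

/-- The block `D_{ij}(X) = ½ ∇_{X_i} ∇_{X_j} u_j(X) + ½ [∇_{X_j} ∇_{X_i} u_i(X)]†` of the game's
Hessian, as a bilinear form. -/
def hessianBlock (i j : Fin N) (X : Profile G.M) (H : Herm (G.M i)) (K : Herm (G.M j)) : ℝ :=
  (1 / 2) * G.mixedDeriv j i j X H K + (1 / 2) * G.mixedDeriv i j i X K H

/-- `D(X) ≺ 0`: the block matrix `(D_{ij}(X))` is negative-definite. -/
def HessianNegDef (X : Profile G.M) : Prop :=
  ∀ H : Profile G.M, H ≠ 0 → ∑ i, ∑ j, G.hessianBlock i j X (H i) (H j) < 0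

/-- The exponential choice map `Y_i ↦ A_i exp(Y_i) / (1 + ‖exp(Y_i)‖)`. -/
def choice (Y : Profile G.M) : Profile G.M := fun i =>
  (G.A i / (1 + (Y i).exp.nuclearNorm)) • (Y i).exp

/-- The history of play up to stage `n`: the σ-algebra generated by `X(0), …, X(n)`, where
`X(k) = choice (Y(k))`. -/
@[reducible] def history {Ω : Type*} (Y : ℕ → Ω → Profile G.M) (n : ℕ) : MeasurableSpace Ω :=
  ⨆ k ≤ n, MeasurableSpace.comap (fun ω => G.choice (Y k ω)) (borel (Profile G.M))

/-- `Y` is the sequence of score matrices of a run of matrix exponential learning with step-sizes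
`γ` and gradient noise `Z`, started at an arbitrary (possibly random) Hermitian `Y(0)`; the noise
has zero mean and subexponential moment growth with constant `σ`, conditionally on the history.
The actions played are `X(n) = choice (Y(n))`. -/
structure IsMXLRun {Ω : Type*} [MeasurableSpace Ω] (P : Measure Ω) (γ : ℕ → ℝ) (σ : ℝ)
    (Y Z : ℕ → Ω → Profile G.M) : Prop where
  measurable_init : StronglyMeasurable (Y 0)
  measurable_noise : ∀ n, StronglyMeasurable (Z n)
  update : ∀ n ω, Y (n + 1) ω = Y n ω + γ n • (G.V (G.choice (Y n ω)) + Z n ω)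
  integrable_noise : ∀ n, ∀ p : ℕ, 1 ≤ p → Integrable (fun ω => ‖Z n ω‖ ^ p) P
  zero_mean : ∀ n, P[Z n | G.history Y n] =ᵐ[P] 0
  subexponential : ∀ n, ∀ p : ℕ, 1 ≤ p →
    P[fun ω => ‖Z n ω‖ ^ p | G.history Y n] ≤ᵐ[P] fun _ => (p.factorial : ℝ) / 2 * σ ^ p

end SemidefiniteGame

end

/-!
The choice map `Q` is the gradient of the potential `f Y = ∑ i, A i * log (1 + tr exp (Y i))`, and
it is cocoercive by Klein's trace inequality applied to the matrix logarithms `Y i - f_i I` of the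
normalized exponentials. So MXL is dual averaging, and `D(X*) ≺ 0` together with the variational
inequality of a Nash equilibrium makes the energy `f - ⟨X*, ·⟩`, which is convex with gradient
`z = Q Y - X*`, decrease along the payoff flow near `X*`.

The difficulty is that at a boundary point `X*` the energy is not small merely because `Q Y` is
close to `X*`, while the neighbourhood `U` must not depend on the scores. Stability is therefore
measured by `‖z‖² - ⟨z, V X*⟩`. If an orbit escapes from scale `r` to scale `2 ^ N * r`, consider
its last upcrossings of the dyadic scales in between. Rescaled to unit size the points `z` lie in a
compact set, so two of them nearly agree: at scales `μ ≤ μ' / 2` the gradients satisfy `z ≈ l z'`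
with `l ≤ 1 / 2`. Convexity at both points bounds the energy drop `Δ` between them by about `l * Δ`,
which is absurd.

The accumulated noise is subtracted from the scores and becomes a perturbation of the point where
the payoff gradient is evaluated. By Doob's maximal inequality it stays small with high
probability, and it converges almost surely.
-/

/-! ### Dual averaging -/

theorem exists_dist_lt_of_totallyBounded {α : Type*} [PseudoMetricSpace α] {s : Set α}
    (hs : TotallyBounded s) {η : ℝ} (hη : 0 < η) :
    ∃ n : ℕ, ∀ u : ℕ → α, (∀ j ≤ n, u j ∈ s) → ∃ j k, j < k ∧ k ≤ n ∧ dist (u j) (u k) < η := by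
  obtain ⟨t, ht, hcover⟩ := Metric.totallyBounded_iff.1 hs (η / 2) (half_pos hη)
  lift t to Finset α using ht
  refine ⟨t.card, fun u hu => ?_⟩
  have hcenter : ∀ j ∈ Finset.range (t.card + 1), ∃ y ∈ t, dist (u j) y < η / 2 := fun j hj => by
    simpa using hcover (hu j (Finset.mem_range_succ_iff.1 hj))
  have : Nonempty α := ⟨u 0⟩
  choose! y hyt hy using hcenter
  obtain ⟨j, hj, k, hk, hne, hjk⟩ := Finset.exists_ne_map_eq_of_card_lt_of_maps_to
    (show t.card < (Finset.range (t.card + 1)).card by simp) hyt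
  have hclose : dist (u j) (u k) < η := by
    have := hy j hj
    have := hy k hk
    rw [← hjk] at this
    linarith [dist_triangle_right (u j) (u k) (y j)]
  rw [Finset.mem_range_succ_iff] at hj hk
  rcases hne.lt_or_gt with hlt | hlt
  · exact ⟨j, k, hlt, hk, hclose⟩
  · exact ⟨k, j, hlt, hj, by rwa [dist_comm]⟩

section ExitTimes

variable {q : ℕ → ℝ} {r : ℝ} {T N : ℕ}

theorem exists_last_upcrossing {B : ℝ} (h0 : q 0 ≤ B) (hT : B < q T) :
    ∃ s < T, q s ≤ B ∧ ∀ i ∈ Set.Ioc s T, B < q i := by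
  classical
  let s := Nat.findGreatest (fun i => q i ≤ B) T
  have hs : q s ≤ B := Nat.findGreatest_spec (P := fun i => q i ≤ B) (Nat.zero_le T) h0
  have hsT : s ≠ T := fun h => hT.not_ge (h ▸ hs)
  exact ⟨s, (Nat.findGreatest_le T).lt_of_ne hsT, hs, fun i hi =>
    not_le.1 (Nat.findGreatest_is_greatest hi.1 hi.2)⟩

theorem exists_dyadic_exit_times (hr : 0 < r) (h0 : q 0 ≤ r ^ 2)
    (hjump : ∀ i, q i ≤ (2 ^ N * r) ^ 2 → q (i + 1) ≤ q i + r ^ 2)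
    (hexit : ∃ n, (2 ^ N * r) ^ 2 < q n) :
    ∃ (T : ℕ) (t : ℕ → ℕ), (∀ i < T, q i ≤ (2 ^ N * r) ^ 2) ∧
      (∀ j ≤ N, t j ≤ T ∧ q (t j) ≤ 2 * (2 ^ j * r) ^ 2 ∧
        ∀ i ∈ Set.Icc (t j) T, (2 ^ j * r) ^ 2 < q i) ∧
      StrictMonoOn t (Set.Iic N) := by
  classical
  have hscale : ∀ {j k : ℕ}, j ≤ k → (2 ^ j * r) ^ 2 ≤ (2 ^ k * r) ^ 2 := fun hjk => by
    gcongr; norm_num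
  have hr_le : ∀ j : ℕ, r ^ 2 ≤ (2 ^ j * r) ^ 2 := fun j => by
    simpa using hscale (Nat.zero_le j)
  have hbefore : ∀ i < Nat.find hexit, q i ≤ (2 ^ N * r) ^ 2 :=
    fun i hi => not_lt.1 (Nat.find_min hexit hi)
  have hlast : ∀ j ≤ N, ∃ s < Nat.find hexit,
      q s ≤ (2 ^ j * r) ^ 2 ∧ ∀ i ∈ Set.Ioc s (Nat.find hexit), (2 ^ j * r) ^ 2 < q i :=
    fun j hj => exists_last_upcrossing (h0.trans (hr_le j))
      ((hscale hj).trans_lt (Nat.find_spec hexit))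
  choose! s hsT hqs hs using hlast
  have hq : ∀ j ≤ N, q (s j + 1) ≤ 2 * (2 ^ j * r) ^ 2 := fun j hj => by
    linarith [hjump (s j) (hbefore _ (hsT j hj)), hqs j hj, hr_le j]
  refine ⟨Nat.find hexit, fun j => s j + 1, hbefore,
    fun j hj => ⟨hsT j hj, hq j hj, fun i hi => hs j hj i hi⟩, fun j hj k hk hjk => ?_⟩
  by_contra! hkj
  have hlow : (2 ^ k * r) ^ 2 < q (s j + 1) := hs k hk _ ⟨hkj, hsT j hj⟩
  have hdouble : (2 ^ (j + 1) * r) ^ 2 ≤ (2 ^ k * r) ^ 2 := hscale hjk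
  have hpos : 0 < (2 ^ j * r) ^ 2 := by positivity
  have : (2 ^ (j + 1) * r) ^ 2 = 4 * (2 ^ j * r) ^ 2 := by ring
  linarith [hq j hj]

end ExitTimes

/-- `Q` is a gradient, with respect to the pairing `p`, of the convex function `f` on the dual
space, in the quantitative form that Baillon and Haddad show to be equivalent to smoothness. -/
structure IsCocoerciveGradient {E F : Type*} [NormedAddCommGroup E] [NormedSpace ℝ E]
    [NormedAddCommGroup F] [NormedSpace ℝ F] (p : E →L[ℝ] F →L[ℝ] ℝ) (f : F → ℝ) (Q : F → E)
    (κ : ℝ) : Prop where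
  κ_pos : 0 < κ
  cocoercive : ∀ Y Y', f Y + p (Q Y) (Y' - Y) + κ * ‖Q Y' - Q Y‖ ^ 2 ≤ f Y'

namespace IsCocoerciveGradient

variable {E F : Type*} [NormedAddCommGroup E] [NormedSpace ℝ E] [NormedAddCommGroup F]
  [NormedSpace ℝ F] {p : E →L[ℝ] F →L[ℝ] ℝ} {f : F → ℝ} {Q : F → E} {κ : ℝ}

theorem add_pairing_le (h : IsCocoerciveGradient p f Q κ) (Y Y' : F) :
    f Y + p (Q Y) (Y' - Y) ≤ f Y' :=
  (le_add_of_nonneg_right (mul_nonneg h.κ_pos.le (sq_nonneg _))).trans (h.cocoercive Y Y')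

theorem norm_sub_le (h : IsCocoerciveGradient p f Q κ) (Y Y' : F) :
    ‖Q Y' - Q Y‖ ≤ ‖p‖ / (2 * κ) * ‖Y' - Y‖ := by
  have hκ := h.κ_pos
  have hsum : 2 * κ * ‖Q Y' - Q Y‖ ^ 2 ≤ p (Q Y' - Q Y) (Y' - Y) := by
    have hYY' := h.cocoercive Y Y'
    have hY'Y := h.cocoercive Y' Y
    rw [norm_sub_rev (Q Y), ← neg_sub Y' Y, map_neg] at hY'Y
    rw [map_sub p, sub_apply]
    linarith
  have hp : p (Q Y' - Q Y) (Y' - Y) ≤ ‖p‖ * ‖Q Y' - Q Y‖ * ‖Y' - Y‖ :=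
    (le_abs_self _).trans (p.le_opNorm₂ _ _)
  rw [div_mul_eq_mul_div, le_div_iff₀ (by positivity)]
  rcases (norm_nonneg (Q Y' - Q Y)).eq_or_lt with h0 | h0
  · rw [← h0, zero_mul]; positivity
  · exact le_of_mul_le_mul_left (by linarith) h0

theorem continuous (h : IsCocoerciveGradient p f Q κ) : Continuous Q :=
  (LipschitzWith.of_dist_le' fun Y Y' => by
    simpa only [dist_eq_norm] using h.norm_sub_le Y' Y).continuous

theorem le_add_pairing_add_sq (h : IsCocoerciveGradient p f Q κ) (Y Y' : F) :
    f Y' ≤ f Y + p (Q Y) (Y' - Y) + ‖p‖ * (‖p‖ / (2 * κ)) * ‖Y' - Y‖ ^ 2 := by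
  have hconv := h.add_pairing_le Y' Y
  have hgrad : p (Q Y' - Q Y) (Y' - Y) ≤ ‖p‖ * (‖p‖ / (2 * κ) * ‖Y' - Y‖) * ‖Y' - Y‖ := by
    refine (le_abs_self _).trans ((p.le_opNorm₂ _ _).trans ?_)
    gcongr
    exact h.norm_sub_le Y Y'
  rw [← neg_sub Y' Y, map_neg] at hconv
  rw [map_sub p, sub_apply] at hgrad
  linarith

end IsCocoerciveGradient

/-- The energy of the dual variable `Y` relative to the primal point `x`: the Fenchel coupling
`f Y + f* x - ⟨x, Y⟩` without the constant `f* x`. -/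
noncomputable def fenchelGap {E F : Type*} [NormedAddCommGroup E] [NormedSpace ℝ E]
    [NormedAddCommGroup F] [NormedSpace ℝ F] (p : E →L[ℝ] F →L[ℝ] ℝ) (f : F → ℝ) (x : E)
    (Y : F) : ℝ :=
  f Y - p x Y

/-- The size of the displacement `z` from a solution of the variational inequality at which the
vector field takes the value `v`: it is quadratic in the directions orthogonal to `v` and linear
in the directions in which `v` strictly decreases. -/
noncomputable def viResidual {E F : Type*} [NormedAddCommGroup E] [NormedSpace ℝ E]
    [NormedAddCommGroup F] [NormedSpace ℝ F] (p : E →L[ℝ] F →L[ℝ] ℝ) (v : F) (z : E) : ℝ :=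
  ‖z‖ ^ 2 - p z v

/-- The point `z`, together with the two scale-invariant quantities that make up its residual at
scale `μ`: `‖z‖` scales like `μ` and `⟨z, v⟩` like `μ²`. -/
noncomputable def rescaled {E F : Type*} [NormedAddCommGroup E] [NormedSpace ℝ E]
    [NormedAddCommGroup F] [NormedSpace ℝ F] (p : E →L[ℝ] F →L[ℝ] ℝ) (v : F) (μ : ℝ)
    (z : E) : E × ℝ :=
  (μ⁻¹ • z, (μ ^ 2)⁻¹ * -p z v)

section Residual

variable {E F : Type*} [NormedAddCommGroup E] [NormedSpace ℝ E] [NormedAddCommGroup F]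
  [NormedSpace ℝ F] {p : E →L[ℝ] F →L[ℝ] ℝ} {v : F} {z z' : E} {μ μ' η ρ e : ℝ}

theorem continuous_viResidual (p : E →L[ℝ] F →L[ℝ] ℝ) (v : F) : Continuous (viResidual p v) := by
  unfold viResidual
  fun_prop

theorem viResidual_zero (p : E →L[ℝ] F →L[ℝ] ℝ) (v : F) : viResidual p v 0 = 0 := by
  simp [viResidual]

theorem norm_sq_le_viResidual (hz : p z v ≤ 0) : ‖z‖ ^ 2 ≤ viResidual p v z := by
  rw [viResidual]; linarith

theorem neg_pairing_le_viResidual : -p z v ≤ viResidual p v z := by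
  rw [viResidual]; linarith [sq_nonneg ‖z‖]

theorem mul_norm_le_viResidual (hz : p z v ≤ 0) (hμ : 0 ≤ μ) (hμz : μ ^ 2 ≤ viResidual p v z) :
    μ * ‖z‖ ≤ viResidual p v z := by
  rcases le_total ‖z‖ μ with h | h
  · nlinarith [norm_nonneg z]
  · nlinarith [norm_nonneg z, norm_sq_le_viResidual hz]

theorem viResidual_le_add (hz : ‖z‖ ≤ ρ) (he : ‖z' - z‖ ≤ e) (he1 : e ≤ 1) :
    viResidual p v z' ≤ viResidual p v z + e * (2 * ρ + 1 + ‖p‖ * ‖v‖) := by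
  have he0 : 0 ≤ e := (norm_nonneg _).trans he
  have hnorm : ‖z'‖ ^ 2 ≤ (‖z‖ + e) ^ 2 := by
    gcongr
    linarith [norm_le_norm_add_norm_sub' z' z]
  have hpair : -p (z' - z) v ≤ ‖p‖ * e * ‖v‖ := by
    refine (neg_le_abs _).trans ((p.le_opNorm₂ _ _).trans ?_)
    gcongr
  rw [map_sub, sub_apply] at hpair
  rw [viResidual, viResidual]
  nlinarith

theorem norm_rescaled_le (hμ : 0 < μ) (hz : p z v ≤ 0) (hzμ : viResidual p v z ≤ 2 * μ ^ 2) :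
    ‖rescaled p v μ z‖ ≤ 2 := by
  refine max_le ?_ ?_
  · simp only [rescaled]
    rw [norm_smul, norm_inv, Real.norm_of_nonneg hμ.le, inv_mul_le_iff₀ hμ]
    exact le_of_sq_le_sq (by nlinarith [norm_sq_le_viResidual hz]) (by positivity)
  · simp only [rescaled]
    rw [Real.norm_of_nonneg (mul_nonneg (by positivity) (neg_nonneg.2 hz)),
      inv_mul_le_iff₀ (by positivity)]
    linarith [neg_pairing_le_viResidual (p := p) (v := v) (z := z)]

theorem norm_sub_smul_le_of_dist_rescaled_le (hμ : 0 < μ)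
    (hdist : dist (rescaled p v μ z) (rescaled p v μ' z') ≤ η) :
    ‖z - (μ / μ') • z'‖ ≤ η * μ := by
  have hfst : ‖μ⁻¹ • z - μ'⁻¹ • z'‖ ≤ η := by
    rw [← dist_eq_norm]; exact (le_max_left _ _).trans hdist
  have hfactor : z - (μ / μ') • z' = μ • (μ⁻¹ • z - μ'⁻¹ • z') := by
    rw [smul_sub, smul_smul, smul_smul, mul_inv_cancel₀ hμ.ne', one_smul, div_eq_mul_inv]
  rw [hfactor, norm_smul, Real.norm_of_nonneg hμ.le, mul_comm]
  gcongr

theorem neg_pairing_sub_smul_le_of_dist_rescaled_le (hμ : 0 < μ) (hμμ' : μ ≤ μ')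
    (hz' : p z' v ≤ 0) (hdist : dist (rescaled p v μ z) (rescaled p v μ' z') ≤ η) :
    -p (z - (μ / μ') • z') v ≤ η * μ ^ 2 := by
  have hμ' : 0 < μ' := hμ.trans_le hμμ'
  have hsnd : (μ ^ 2)⁻¹ * -p z v - (μ' ^ 2)⁻¹ * -p z' v ≤ η :=
    (le_abs_self _).trans ((le_max_right _ _).trans hdist)
  have hfactor : -p z v - (μ / μ') ^ 2 * -p z' v =
      μ ^ 2 * ((μ ^ 2)⁻¹ * -p z v - (μ' ^ 2)⁻¹ * -p z' v) := by
    field_simp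
  have hscale : (μ / μ') ^ 2 * -p z' v ≤ μ / μ' * -p z' v := by
    refine mul_le_mul_of_nonneg_right ?_ (neg_nonneg.2 hz')
    exact pow_le_of_le_one (by positivity) ((div_le_one hμ').2 hμμ') two_ne_zero
  have hη : μ ^ 2 * ((μ ^ 2)⁻¹ * -p z v - (μ' ^ 2)⁻¹ * -p z' v) ≤ μ ^ 2 * η := by gcongr
  rw [map_sub, map_smul, sub_apply, smul_apply, smul_eq_mul]
  linarith

end Residual

/-- The data of dual averaging `Y ↦ Q Y` along a vector field `V` on the primal space: `x` is a
point of the domain of the convex conjugate of `f` that solves the variational inequality of `V`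
over the range of `Q`, and at distance at most `R` from it `V` is strongly decreasing with modulus
`c` and satisfies a Lipschitz estimate with constant `C`. -/
structure IsDualAveraging {E F : Type*} [NormedAddCommGroup E] [NormedSpace ℝ E]
    [NormedAddCommGroup F] [NormedSpace ℝ F] (p : E →L[ℝ] F →L[ℝ] ℝ) (f : F → ℝ) (Q : F → E)
    (V : E → F) (x : E) (κ c C R : ℝ) : Prop extends IsCocoerciveGradient p f Q κ where
  c_pos : 0 < c
  c_le_one : c ≤ 1
  C_nonneg : 0 ≤ C
  R_pos : 0 < R
  lower : ∀ Y, p x Y ≤ f Y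
  vi : ∀ Y, p (Q Y - x) (V x) ≤ 0
  monotone : ∀ Y, ‖Q Y - x‖ ≤ R → p (Q Y - x) (V (Q Y) - V x) ≤ -c * ‖Q Y - x‖ ^ 2
  lipschitz_at : ∀ Y, ‖Q Y - x‖ ≤ R → ‖V (Q Y) - V x‖ ≤ C * ‖Q Y - x‖

/-- An orbit of dual averaging in which the vector field is evaluated at the image of the score
`Y n` shifted by a perturbation `W n`; steps and perturbations are at most `θ`. -/
structure IsPerturbedOrbit {E F : Type*} [NormedAddCommGroup F] [NormedSpace ℝ F] (Q : F → E)
    (V : E → F) (θ : ℝ) (γ : ℕ → ℝ) (Y W : ℕ → F) : Prop where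
  step_pos : ∀ n, 0 < γ n
  step_le : ∀ n, γ n ≤ θ
  norm_le : ∀ n, ‖W n‖ ≤ θ
  update : ∀ n, Y (n + 1) = Y n + γ n • V (Q (Y n + W n))

namespace IsPerturbedOrbit

variable {E F : Type*} [NormedAddCommGroup F] [NormedSpace ℝ F] {Q : F → E} {V : E → F} {θ : ℝ}
  {γ : ℕ → ℝ} {Y W : ℕ → F}

theorem bound_nonneg (o : IsPerturbedOrbit Q V θ γ Y W) : 0 ≤ θ :=
  (o.step_pos 0).le.trans (o.step_le 0)

theorem sum_step_nonneg (o : IsPerturbedOrbit Q V θ γ Y W) (a b : ℕ) :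
    0 ≤ ∑ i ∈ Finset.Ico a b, γ i :=
  Finset.sum_nonneg fun i _ => (o.step_pos i).le

theorem sub_eq_sum (o : IsPerturbedOrbit Q V θ γ Y W) {a b : ℕ} (hab : a ≤ b) :
    Y b - Y a = ∑ i ∈ Finset.Ico a b, γ i • V (Q (Y i + W i)) := by
  rw [← Finset.sum_Ico_sub Y hab]
  exact Finset.sum_congr rfl fun i _ => by rw [o.update, add_sub_cancel_left]

/-- Restarting at a late time `M` moves the perturbation accumulated so far into the score, which
leaves only its small tail. -/
theorem eventually_shift (o : IsPerturbedOrbit Q V θ γ Y W) (hγ : Tendsto γ atTop (𝓝 0))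
    (hW : CauchySeq W) {θ' : ℝ} (hθ' : 0 < θ') :
    ∀ᶠ M in atTop, IsPerturbedOrbit Q V θ' (fun n => γ (n + M)) (fun n => Y (n + M) + W M)
      (fun n => W (n + M) - W M) := by
  obtain ⟨M₁, hM₁⟩ := eventually_atTop.1 (hγ.eventually_le_const hθ')
  obtain ⟨M₂, hM₂⟩ := Metric.cauchySeq_iff.1 hW θ' hθ'
  filter_upwards [eventually_ge_atTop M₁, eventually_ge_atTop M₂] with M hMM₁ hMM₂
  refine ⟨fun n => o.step_pos _, fun n => hM₁ _ (by omega), fun n => ?_, fun n => ?_⟩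
  · rw [← dist_eq_norm]
    exact (hM₂ _ (by omega) _ hMM₂).le
  · rw [add_right_comm n 1 M, o.update, add_add_sub_cancel, add_right_comm]

end IsPerturbedOrbit

/-- The constant `K` such that, along an orbit with steps and perturbations at most `θ`, the energy
and the actions differ by at most `K θ` per unit of time from those of the continuous-time flow.
Here `‖v‖ + C * R` bounds the vector field near the solution and `‖p‖ / (2 * κ)` is the Lipschitz
constant of `Q`. -/
noncomputable def errorRate {E F : Type*} [NormedAddCommGroup E] [NormedSpace ℝ E]
    [NormedAddCommGroup F] [NormedSpace ℝ F] (p : E →L[ℝ] F →L[ℝ] ℝ) (v : F) (κ C R : ℝ) : ℝ :=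
  ‖p‖ * (‖p‖ / (2 * κ)) * (‖v‖ + C * R) * (1 + (‖v‖ + C * R)) +
    ‖p‖ / (2 * κ) * (‖v‖ + C * R + 2) + 1

namespace IsDualAveraging

variable {E F : Type*} [NormedAddCommGroup E] [NormedSpace ℝ E] [NormedAddCommGroup F]
  [NormedSpace ℝ F] {p : E →L[ℝ] F →L[ℝ] ℝ} {f : F → ℝ} {Q : F → E} {V : E → F} {x : E}
  {κ c C R : ℝ}

theorem norm_field_le (h : IsDualAveraging p f Q V x κ c C R) {Y : F} (hY : ‖Q Y - x‖ ≤ R) :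
    ‖V (Q Y)‖ ≤ ‖V x‖ + C * R := by
  have hlip : C * ‖Q Y - x‖ ≤ C * R := mul_le_mul_of_nonneg_left hY h.C_nonneg
  linarith [norm_le_norm_add_norm_sub' (V (Q Y)) (V x), h.lipschitz_at Y hY]

theorem pairing_field_le_neg_viResidual (h : IsDualAveraging p f Q V x κ c C R) {Y : F}
    (hY : ‖Q Y - x‖ ≤ R) : p (Q Y - x) (V (Q Y)) ≤ -c * viResidual p (V x) (Q Y - x) := by
  have hmono := h.monotone Y hY
  have hvi : c * -p (Q Y - x) (V x) ≤ 1 * -p (Q Y - x) (V x) :=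
    mul_le_mul_of_nonneg_right h.c_le_one (neg_nonneg.2 (h.vi Y))
  rw [map_sub (p (Q Y - x))] at hmono
  rw [viResidual]
  linarith

theorem norm_sq_le_viResidual (h : IsDualAveraging p f Q V x κ c C R) (Y : F) :
    ‖Q Y - x‖ ^ 2 ≤ viResidual p (V x) (Q Y - x) :=
  _root_.norm_sq_le_viResidual (h.vi Y)

theorem errorRate_pos (h : IsDualAveraging p f Q V x κ c C R) : 0 < errorRate p (V x) κ C R := by
  have hκ := h.κ_pos
  have hR := h.R_pos
  have hC := h.C_nonneg
  rw [errorRate]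
  positivity

theorem energy_error_le_errorRate (h : IsDualAveraging p f Q V x κ c C R) :
    ‖p‖ * (‖p‖ / (2 * κ)) * (‖V x‖ + C * R) * (1 + (‖V x‖ + C * R)) ≤ errorRate p (V x) κ C R := by
  have hκ := h.κ_pos
  have hR := h.R_pos
  have hC := h.C_nonneg
  rw [errorRate, add_assoc]
  exact le_add_of_nonneg_right (by positivity)

theorem pairing_error_le_errorRate (h : IsDualAveraging p f Q V x κ c C R) :
    ‖p‖ * (‖p‖ / (2 * κ)) * (‖V x‖ + C * R) ≤ errorRate p (V x) κ C R := by
  have hκ := h.κ_pos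
  have hR := h.R_pos
  have hC := h.C_nonneg
  have hv : 0 ≤ ‖V x‖ + C * R := by positivity
  exact (le_mul_of_one_le_right (by positivity) (le_add_of_nonneg_right hv)).trans
    h.energy_error_le_errorRate

theorem action_error_le_errorRate (h : IsDualAveraging p f Q V x κ c C R) :
    ‖p‖ / (2 * κ) * (‖V x‖ + C * R + 2) ≤ errorRate p (V x) κ C R := by
  have hκ := h.κ_pos
  have hR := h.R_pos
  have hC := h.C_nonneg
  have henergy : 0 ≤ ‖p‖ * (‖p‖ / (2 * κ)) * (‖V x‖ + C * R) * (1 + (‖V x‖ + C * R)) := by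
    positivity
  rw [errorRate]
  linarith

section Orbit

variable {θ : ℝ} {γ : ℕ → ℝ} {Y W : ℕ → F}

theorem abs_pairing_perturbation_le (h : IsDualAveraging p f Q V x κ c C R)
    (o : IsPerturbedOrbit Q V θ γ Y W) (n : ℕ) (D : F) :
    |p (Q (Y n) - Q (Y n + W n)) D| ≤ ‖p‖ * (‖p‖ / (2 * κ) * θ) * ‖D‖ := by
  have hκ := h.κ_pos
  have hQ : ‖Q (Y n) - Q (Y n + W n)‖ ≤ ‖p‖ / (2 * κ) * θ := by
    refine (h.norm_sub_le _ _).trans ?_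
    rw [sub_add_cancel_left, norm_neg]
    gcongr
    exact o.norm_le n
  refine (p.le_opNorm₂ _ _).trans ?_
  gcongr

theorem fenchelGap_succ_le (h : IsDualAveraging p f Q V x κ c C R)
    (o : IsPerturbedOrbit Q V θ γ Y W) {i : ℕ} (hi : ‖Q (Y i + W i) - x‖ ≤ R) :
    fenchelGap p f x (Y (i + 1)) ≤ fenchelGap p f x (Y i) + γ i *
      (p (Q (Y i + W i) - x) (V (Q (Y i + W i))) + errorRate p (V x) κ C R * θ) := by
  set X := Q (Y i + W i)
  set B := ‖V x‖ + C * R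
  set L := ‖p‖ / (2 * κ) with hL
  have hκ := h.κ_pos
  have hγ := o.step_pos i
  have hθ := o.bound_nonneg
  have hVB : ‖V X‖ ≤ B := h.norm_field_le hi
  have hB : 0 ≤ B := (norm_nonneg _).trans hVB
  have hsmooth := h.le_add_pairing_add_sq (Y i) (Y (i + 1))
  rw [o.update, add_sub_cancel_left, norm_smul, Real.norm_of_nonneg hγ.le, map_smul, smul_eq_mul,
    ← hL] at hsmooth
  have hpert : p (Q (Y i) - X) (V X) ≤ ‖p‖ * (L * θ) * B :=
    (abs_le.1 (h.abs_pairing_perturbation_le o i (V X))).2.trans (by gcongr)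
  have hsq : ‖p‖ * L * (γ i * ‖V X‖) ^ 2 ≤ γ i * (‖p‖ * L * B * B * θ) := by
    calc ‖p‖ * L * (γ i * ‖V X‖) ^ 2 = γ i * (‖p‖ * L * ‖V X‖ * ‖V X‖ * γ i) := by ring
      _ ≤ γ i * (‖p‖ * L * B * B * θ) := by
        gcongr
        exact o.step_le i
  have hrate : ‖p‖ * L * B * (1 + B) * θ ≤ errorRate p (V x) κ C R * θ :=
    mul_le_mul_of_nonneg_right h.energy_error_le_errorRate hθ
  have hstep : γ i * (p (Q (Y i)) (V X) - p x (V X) + ‖p‖ * L * B * B * θ) ≤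
      γ i * (p (X - x) (V X) + errorRate p (V x) κ C R * θ) := by
    refine mul_le_mul_of_nonneg_left ?_ hγ.le
    simp only [map_sub, sub_apply] at hpert ⊢
    linarith
  rw [fenchelGap, fenchelGap, o.update, map_add, map_smul, smul_eq_mul]
  linarith

theorem norm_sub_le_sum_step (h : IsDualAveraging p f Q V x κ c C R)
    (o : IsPerturbedOrbit Q V θ γ Y W) {a b : ℕ} (hab : a ≤ b)
    (hR : ∀ i ∈ Finset.Ico a b, ‖Q (Y i + W i) - x‖ ≤ R) :
    ‖Y b - Y a‖ ≤ (‖V x‖ + C * R) * ∑ i ∈ Finset.Ico a b, γ i := by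
  rw [o.sub_eq_sum hab, Finset.mul_sum]
  refine (norm_sum_le _ _).trans (Finset.sum_le_sum fun i hi => ?_)
  rw [norm_smul, Real.norm_of_nonneg (o.step_pos i).le, mul_comm]
  exact mul_le_mul_of_nonneg_right (h.norm_field_le (hR i hi)) (o.step_pos i).le

theorem fenchelGap_add_pairing_le (h : IsDualAveraging p f Q V x κ c C R)
    (o : IsPerturbedOrbit Q V θ γ Y W) (m n : ℕ) :
    fenchelGap p f x (Y m) + p (Q (Y m + W m) - x) (Y n - Y m) -
      ‖p‖ * (‖p‖ / (2 * κ) * θ) * ‖Y n - Y m‖ ≤ fenchelGap p f x (Y n) := by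
  have hconv := h.add_pairing_le (Y m) (Y n)
  have hpert := (abs_le.1 (h.abs_pairing_perturbation_le o m (Y n - Y m))).1
  rw [fenchelGap, fenchelGap]
  simp only [map_sub, sub_apply] at hconv hpert ⊢
  linarith

theorem norm_action_sub_le (h : IsDualAveraging p f Q V x κ c C R)
    (o : IsPerturbedOrbit Q V θ γ Y W) {i : ℕ} (hi : ‖Q (Y i + W i) - x‖ ≤ R) :
    ‖Q (Y (i + 1) + W (i + 1)) - Q (Y i + W i)‖ ≤ errorRate p (V x) κ C R * θ := by
  have hκ := h.κ_pos
  have hθ := o.bound_nonneg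
  have hγ := o.step_pos i
  have hstep : ‖γ i • V (Q (Y i + W i))‖ ≤ θ * (‖V x‖ + C * R) := by
    rw [norm_smul, Real.norm_of_nonneg hγ.le]
    gcongr
    exacts [o.step_le i, h.norm_field_le hi]
  have hscore : ‖Y (i + 1) + W (i + 1) - (Y i + W i)‖ ≤ (‖V x‖ + C * R + 2) * θ := by
    rw [o.update, add_sub_add_comm, add_sub_cancel_left]
    linarith [norm_add_le (γ i • V (Q (Y i + W i))) (W (i + 1) - W i),
      norm_sub_le (W (i + 1)) (W i), o.norm_le i, o.norm_le (i + 1)]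
  calc ‖Q (Y (i + 1) + W (i + 1)) - Q (Y i + W i)‖
      ≤ ‖p‖ / (2 * κ) * ((‖V x‖ + C * R + 2) * θ) := (h.norm_sub_le _ _).trans (by gcongr)
    _ = ‖p‖ / (2 * κ) * (‖V x‖ + C * R + 2) * θ := (mul_assoc _ _ _).symm
    _ ≤ errorRate p (V x) κ C R * θ := mul_le_mul_of_nonneg_right h.action_error_le_errorRate hθ

theorem fenchelGap_le_sub_sum_viResidual (h : IsDualAveraging p f Q V x κ c C R)
    (o : IsPerturbedOrbit Q V θ γ Y W) {a b : ℕ} (hab : a ≤ b)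
    (hR : ∀ i ∈ Finset.Ico a b, ‖Q (Y i + W i) - x‖ ≤ R) :
    fenchelGap p f x (Y b) ≤ fenchelGap p f x (Y a) -
      c * ∑ i ∈ Finset.Ico a b, γ i * viResidual p (V x) (Q (Y i + W i) - x) +
      errorRate p (V x) κ C R * θ * ∑ i ∈ Finset.Ico a b, γ i := by
  have htel : fenchelGap p f x (Y b) - fenchelGap p f x (Y a) ≤ ∑ i ∈ Finset.Ico a b,
      (-(c * (γ i * viResidual p (V x) (Q (Y i + W i) - x))) +
        errorRate p (V x) κ C R * θ * γ i) := by
    rw [← Finset.sum_Ico_sub (fun i => fenchelGap p f x (Y i)) hab]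
    refine Finset.sum_le_sum fun i hi => ?_
    have hstep := h.fenchelGap_succ_le o (hR i hi)
    have hdec := mul_le_mul_of_nonneg_left (h.pairing_field_le_neg_viResidual (hR i hi))
      (o.step_pos i).le
    linarith
  rw [Finset.sum_add_distrib, Finset.sum_neg_distrib, ← Finset.mul_sum, ← Finset.mul_sum] at htel
  linarith

theorem neg_pairing_sub_le (h : IsDualAveraging p f Q V x κ c C R)
    (o : IsPerturbedOrbit Q V θ γ Y W) {a b : ℕ} (hab : a ≤ b) {μ η : ℝ} (hμ : 0 ≤ μ)
    (hη : 0 ≤ η) (hR : ∀ i ∈ Finset.Ico a b, ‖Q (Y i + W i) - x‖ ≤ R)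
    (hμq : ∀ i ∈ Finset.Ico a b, μ ^ 2 ≤ viResidual p (V x) (Q (Y i + W i) - x)) {ζ : E}
    (hζ : ‖ζ‖ ≤ η * μ) (hζv : -p ζ (V x) ≤ η * μ ^ 2) :
    -p ζ (Y b - Y a) ≤ η * (1 + ‖p‖ * C) *
      ∑ i ∈ Finset.Ico a b, γ i * viResidual p (V x) (Q (Y i + W i) - x) := by
  rw [o.sub_eq_sum hab, map_sum, Finset.mul_sum, ← Finset.sum_neg_distrib]
  refine Finset.sum_le_sum fun i hi => ?_
  set X := Q (Y i + W i)
  have hC := h.C_nonneg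
  have hdiff : -p ζ (V X - V x) ≤ η * (‖p‖ * C) * viResidual p (V x) (X - x) := by
    calc -p ζ (V X - V x) ≤ ‖p‖ * ‖ζ‖ * ‖V X - V x‖ := (neg_le_abs _).trans (p.le_opNorm₂ _ _)
      _ ≤ ‖p‖ * (η * μ) * (C * ‖X - x‖) := by
        gcongr
        exact h.lipschitz_at _ (hR i hi)
      _ = η * (‖p‖ * C) * (μ * ‖X - x‖) := by ring
      _ ≤ η * (‖p‖ * C) * viResidual p (V x) (X - x) := by
        gcongr
        exact mul_norm_le_viResidual (h.vi _) hμ (hμq i hi)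
  have hconst : -p ζ (V x) ≤ η * viResidual p (V x) (X - x) :=
    hζv.trans (mul_le_mul_of_nonneg_left (hμq i hi) hη)
  rw [map_smul, smul_eq_mul, ← mul_neg, mul_left_comm]
  refine mul_le_mul_of_nonneg_left ?_ (o.step_pos i).le
  rw [map_sub (p ζ)] at hdiff
  linarith

theorem perturbation_mul_norm_sub_le (h : IsDualAveraging p f Q V x κ c C R)
    (o : IsPerturbedOrbit Q V θ γ Y W) {a b : ℕ} (hab : a ≤ b)
    (hR : ∀ i ∈ Finset.Ico a b, ‖Q (Y i + W i) - x‖ ≤ R) :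
    ‖p‖ * (‖p‖ / (2 * κ) * θ) * ‖Y b - Y a‖ ≤
      errorRate p (V x) κ C R * θ * ∑ i ∈ Finset.Ico a b, γ i := by
  have hκ := h.κ_pos
  have hθ := o.bound_nonneg
  have hτ := o.sum_step_nonneg a b
  calc ‖p‖ * (‖p‖ / (2 * κ) * θ) * ‖Y b - Y a‖
      ≤ ‖p‖ * (‖p‖ / (2 * κ) * θ) * ((‖V x‖ + C * R) * ∑ i ∈ Finset.Ico a b, γ i) := by
        gcongr; exact h.norm_sub_le_sum_step o hab hR
    _ = ‖p‖ * (‖p‖ / (2 * κ)) * (‖V x‖ + C * R) * (θ * ∑ i ∈ Finset.Ico a b, γ i) := by ring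
    _ ≤ errorRate p (V x) κ C R * (θ * ∑ i ∈ Finset.Ico a b, γ i) := by
        gcongr; exact h.pairing_error_le_errorRate
    _ = errorRate p (V x) κ C R * θ * ∑ i ∈ Finset.Ico a b, γ i := (mul_assoc _ _ _).symm

/-- An action and a nearly parallel one reached later at a larger scale would violate convexity of
the energy: seen from the two points, the energy drop along the orbit is the same number, but the
gradients differ by the factor `l`. -/
theorem half_lt_of_nearly_parallel (h : IsDualAveraging p f Q V x κ c C R)
    (o : IsPerturbedOrbit Q V θ γ Y W) {a b : ℕ} (hab : a < b) {μ η l : ℝ} (hμ : 0 < μ)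
    (hη : 0 ≤ η) (hηc : η * (1 + ‖p‖ * C) ≤ c / 8) (hl : 0 ≤ l)
    (hθ : errorRate p (V x) κ C R * θ ≤ c * μ ^ 2 / 16)
    (hR : ∀ i ∈ Finset.Ico a b, ‖Q (Y i + W i) - x‖ ≤ R)
    (hμq : ∀ i ∈ Finset.Ico a b, μ ^ 2 ≤ viResidual p (V x) (Q (Y i + W i) - x))
    (hz : ‖Q (Y a + W a) - x - l • (Q (Y b + W b) - x)‖ ≤ η * μ)
    (hzv : -p (Q (Y a + W a) - x - l • (Q (Y b + W b) - x)) (V x) ≤ η * μ ^ 2) :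
    1 / 2 < l := by
  by_contra! hl2
  set S := ∑ i ∈ Finset.Ico a b, γ i * viResidual p (V x) (Q (Y i + W i) - x)
  set τ := ∑ i ∈ Finset.Ico a b, γ i
  set K := errorRate p (V x) κ C R
  set Δ := fenchelGap p f x (Y a) - fenchelGap p f x (Y b)
  have hc := h.c_pos
  have hτ : 0 < τ := Finset.sum_pos (fun i _ => o.step_pos i) (Finset.nonempty_Ico.2 hab)
  have hτS : μ ^ 2 * τ ≤ S := by
    rw [Finset.mul_sum]
    exact Finset.sum_le_sum fun i hi => by
      rw [mul_comm]; exact mul_le_mul_of_nonneg_left (hμq i hi) (o.step_pos i).le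
  have hS : 0 < S := lt_of_lt_of_le (by positivity) hτS
  have hcS : 0 < c * S := mul_pos hc hS
  have herr : K * θ * τ ≤ c * S / 16 := by
    calc K * θ * τ ≤ c * μ ^ 2 / 16 * τ := by gcongr
      _ = c * (μ ^ 2 * τ) / 16 := by ring
      _ ≤ c * S / 16 := by gcongr
  have hpert := h.perturbation_mul_norm_sub_le o hab.le hR
  have hdrop : c * S - K * θ * τ ≤ Δ := by
    linarith [h.fenchelGap_le_sub_sum_viResidual o hab.le hR]
  have hfrom_a : p (Q (Y a + W a) - x) (Y b - Y a) ≤ K * θ * τ - Δ := by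
    linarith [h.fenchelGap_add_pairing_le o a b]
  have hfrom_b : -(Δ + K * θ * τ) ≤ p (Q (Y b + W b) - x) (Y b - Y a) := by
    have := h.fenchelGap_add_pairing_le o b a
    rw [← neg_sub (Y b), map_neg, norm_neg] at this
    linarith
  have hparallel := h.neg_pairing_sub_le o hab.le hμ.le hη hR hμq hz hzv
  rw [map_sub p, map_smul, sub_apply, smul_apply, smul_eq_mul] at hparallel
  have hclose : η * (1 + ‖p‖ * C) * S ≤ c / 8 * S := by gcongr
  have hscaled := mul_le_mul_of_nonneg_left hfrom_b hl
  have hl_drop : l * (Δ + K * θ * τ) ≤ 1 / 2 * (Δ + K * θ * τ) :=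
    mul_le_mul_of_nonneg_right hl2 (by linarith)
  linarith

end Orbit

section Stability

variable [FiniteDimensional ℝ E]

/-- By pigeonhole, among the rescaled actions at the last upcrossings of sufficiently many dyadic
scales two nearly coincide, which is what `half_lt_of_nearly_parallel` forbids. -/
theorem exists_scales_forall_viResidual_le (h : IsDualAveraging p f Q V x κ c C R) :
    ∃ N : ℕ, ∀ r > 0, 2 ^ N * r ≤ R → ∀ (θ : ℝ) (γ : ℕ → ℝ) (Y W : ℕ → F),
      IsPerturbedOrbit Q V θ γ Y W → errorRate p (V x) κ C R * θ ≤ c * r ^ 2 / 16 →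
      viResidual p (V x) (Q (Y 0 + W 0) - x) ≤ r ^ 2 →
      (∀ i, viResidual p (V x) (Q (Y i + W i) - x) ≤ (2 ^ N * r) ^ 2 →
        viResidual p (V x) (Q (Y (i + 1) + W (i + 1)) - x) ≤
          viResidual p (V x) (Q (Y i + W i) - x) + r ^ 2) →
      ∀ n, viResidual p (V x) (Q (Y n + W n) - x) ≤ (2 ^ N * r) ^ 2 := by
  have hc := h.c_pos
  have hC := h.C_nonneg
  have : ProperSpace E := FiniteDimensional.proper ℝ E
  set η := c / 8 / (1 + ‖p‖ * C)
  have hη : 0 < η := by positivity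
  obtain ⟨N, hN⟩ := exists_dist_lt_of_totallyBounded
    (isCompact_closedBall (0 : E × ℝ) 2).totallyBounded hη
  refine ⟨N, fun r hr hrR θ γ Y W o hθ h0 hjump => ?_⟩
  by_contra! hexit
  obtain ⟨T, t, hbefore, ht, htmono⟩ := exists_dyadic_exit_times hr h0 hjump hexit
  set z : ℕ → E := fun i => Q (Y i + W i) - x
  obtain ⟨j, k, hjk, hkN, hdist⟩ := hN (fun j => rescaled p (V x) (2 ^ j * r) (z (t j)))
    fun j hj => mem_closedBall_zero_iff.2
      (norm_rescaled_le (by positivity) (h.vi _) (ht j hj).2.1)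
  have hjN : j ≤ N := hjk.le.trans hkN
  have hratio : 2 ^ j * r / (2 ^ k * r) ≤ 1 / 2 := by
    have hpow : (2 : ℝ) ^ (j + 1) ≤ 2 ^ k := pow_le_pow_right₀ one_le_two hjk
    rw [mul_div_mul_right _ _ hr.ne', div_le_div_iff₀ (by positivity) two_pos]
    linarith [pow_succ (2 : ℝ) j]
  have hscale : 2 ^ j * r ≤ 2 ^ k * r := by gcongr; exact one_le_two
  have hR : ∀ i ∈ Finset.Ico (t j) (t k), ‖z i‖ ≤ R := fun i hi =>
    (le_of_sq_le_sq ((h.norm_sq_le_viResidual _).trans (hbefore i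
      ((Finset.mem_Ico.1 hi).2.trans_le (ht k hkN).1))) (by positivity)).trans hrR
  have hθj : errorRate p (V x) κ C R * θ ≤ c * (2 ^ j * r) ^ 2 / 16 := by
    refine hθ.trans ?_
    gcongr
    exact le_mul_of_one_le_left hr.le (one_le_pow₀ one_le_two)
  refine absurd hratio (not_le.2 (h.half_lt_of_nearly_parallel o (htmono hjN hkN hjk)
    (by positivity) hη.le (div_mul_cancel₀ _ (by positivity)).le (by positivity) hθj hR
    (fun i hi => ((ht j hjN).2.2 i ⟨(Finset.mem_Ico.1 hi).1,
      (Finset.mem_Ico.1 hi).2.le.trans (ht k hkN).1⟩).le)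
    (norm_sub_smul_le_of_dist_rescaled_le (by positivity) hdist.le)
    (neg_pairing_sub_smul_le_of_dist_rescaled_le (by positivity) hscale (h.vi _) hdist.le)))

/-- The actions stay close to `x` uniformly in the dual starting point. The energy alone does not
give this: at a boundary point `x` it need not be small when `Q (Y 0)` is close to `x`. -/
theorem exists_forall_norm_sub_le (h : IsDualAveraging p f Q V x κ c C R) {ρ : ℝ} (hρ : 0 < ρ)
    (hρR : ρ ≤ R) :
    ∃ r > 0, ∃ θ > 0, ∀ (γ : ℕ → ℝ) (Y W : ℕ → F), IsPerturbedOrbit Q V θ γ Y W →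
      ‖Q (Y 0 + W 0) - x‖ < r → ∀ n, ‖Q (Y n + W n) - x‖ ≤ ρ := by
  obtain ⟨N, hN⟩ := h.exists_scales_forall_viResidual_le
  have hc := h.c_pos
  have hK := h.errorRate_pos
  set r₀ := ρ / 2 ^ N
  have hr₀_pos : 0 < r₀ := by positivity
  have hρr₀ : 2 ^ N * r₀ = ρ := mul_div_cancel₀ _ (by positivity)
  set A := 2 * ρ + 1 + ‖p‖ * ‖V x‖
  have hA : 0 < A := by positivity
  set e := min 1 (min (c * r₀ ^ 2 / 16) (r₀ ^ 2 / A))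
  have he : 0 < e := by positivity
  have heA : e * A ≤ r₀ ^ 2 :=
    (le_div_iff₀ hA).1 ((min_le_right _ _).trans (min_le_right _ _))
  obtain ⟨r, hr, hr_small⟩ := Metric.eventually_nhds_iff.1
    ((continuous_viResidual p (V x)).continuousAt.eventually_le_const
      (show viResidual p (V x) 0 < r₀ ^ 2 by rw [viResidual_zero]; positivity))
  refine ⟨r, hr, e / errorRate p (V x) κ C R, div_pos he hK, fun γ Y W o hstart => ?_⟩
  have hθ : errorRate p (V x) κ C R * (e / errorRate p (V x) κ C R) = e := mul_div_cancel₀ _ hK.ne'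
  have hsmall : ∀ i, viResidual p (V x) (Q (Y i + W i) - x) ≤ ρ ^ 2 → ‖Q (Y i + W i) - x‖ ≤ ρ :=
    fun i hi => le_of_sq_le_sq ((h.norm_sq_le_viResidual _).trans hi) hρ.le
  have hjump : ∀ i, viResidual p (V x) (Q (Y i + W i) - x) ≤ ρ ^ 2 →
      viResidual p (V x) (Q (Y (i + 1) + W (i + 1)) - x) ≤
        viResidual p (V x) (Q (Y i + W i) - x) + r₀ ^ 2 := fun i hi => by
    have hstep := h.norm_action_sub_le o ((hsmall i hi).trans hρR)
    rw [hθ, ← sub_sub_sub_cancel_right _ _ x] at hstep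
    exact (viResidual_le_add (hsmall i hi) hstep (min_le_left _ _)).trans (by linarith)
  exact fun n => hsmall n (hρr₀ ▸ hN r₀ hr₀_pos (hρr₀.trans_le hρR) _ γ Y W o
    (hθ.trans_le ((min_le_right _ _).trans (min_le_left _ _)))
    (hr_small (by simpa using hstart)) (hρr₀.symm ▸ hjump) n)

end Stability

section Convergence

variable {θ : ℝ} {γ : ℕ → ℝ} {Y W : ℕ → F}

theorem summable_step_of_le_norm_sub (h : IsDualAveraging p f Q V x κ c C R)
    (o : IsPerturbedOrbit Q V θ γ Y W) {ρ : ℝ} (hρ : 0 < ρ)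
    (hθ : errorRate p (V x) κ C R * θ ≤ c * ρ ^ 2 / 2) (hR : ∀ n, ‖Q (Y n + W n) - x‖ ≤ R)
    (hfar : ∀ n, ρ ≤ ‖Q (Y n + W n) - x‖) : Summable γ := by
  have hcρ : 0 < c * ρ ^ 2 / 2 := by have := h.c_pos; positivity
  have hdrop : ∀ n, c * ρ ^ 2 / 2 * ∑ i ∈ Finset.range n, γ i ≤ fenchelGap p f x (Y 0) := by
    intro n
    rw [Finset.range_eq_Ico]
    have hgap : 0 ≤ fenchelGap p f x (Y n) := sub_nonneg.2 (h.lower _)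
    have hsum : ρ ^ 2 * ∑ i ∈ Finset.Ico 0 n, γ i ≤
        ∑ i ∈ Finset.Ico 0 n, γ i * viResidual p (V x) (Q (Y i + W i) - x) := by
      rw [Finset.mul_sum]
      refine Finset.sum_le_sum fun i _ => ?_
      rw [mul_comm]
      refine mul_le_mul_of_nonneg_left ?_ (o.step_pos i).le
      exact (pow_le_pow_left₀ hρ.le (hfar i) 2).trans (h.norm_sq_le_viResidual _)
    have herr := mul_le_mul_of_nonneg_right hθ (o.sum_step_nonneg 0 n)
    have hdec := mul_le_mul_of_nonneg_left hsum h.c_pos.le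
    linarith [h.fenchelGap_le_sub_sum_viResidual o (Nat.zero_le n) fun i _ => hR i]
  exact summable_of_sum_range_le (fun n => (o.step_pos n).le) fun n =>
    (le_div_iff₀' hcρ).2 (hdrop n)

theorem frequently_norm_sub_lt (h : IsDualAveraging p f Q V x κ c C R)
    (o : IsPerturbedOrbit Q V θ γ Y W) (hγ : Tendsto γ atTop (𝓝 0)) (hγs : ¬ Summable γ)
    (hW : CauchySeq W) (hR : ∀ n, ‖Q (Y n + W n) - x‖ ≤ R) {ρ : ℝ} (hρ : 0 < ρ) :
    ∃ᶠ n in atTop, ‖Q (Y n + W n) - x‖ < ρ := by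
  intro hfar
  have hc := h.c_pos
  have hK := h.errorRate_pos
  have hθ : 0 < c * ρ ^ 2 / 2 / errorRate p (V x) κ C R := by positivity
  obtain ⟨m, hm⟩ := eventually_atTop.1 hfar
  obtain ⟨M, hmM, o'⟩ := ((eventually_ge_atTop m).and (o.eventually_shift hγ hW hθ)).exists
  refine hγs ((summable_nat_add_iff M).1 (h.summable_step_of_le_norm_sub o' hρ
    (mul_div_cancel₀ _ hK.ne').le (fun n => ?_) fun n => ?_))
  · simpa using hR (n + M)
  · simpa using hm (n + M) (by omega)

theorem exists_forall_tendsto [FiniteDimensional ℝ E] (h : IsDualAveraging p f Q V x κ c C R) :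
    ∃ r > 0, ∃ θ > 0, ∀ (γ : ℕ → ℝ) (Y W : ℕ → F), IsPerturbedOrbit Q V θ γ Y W →
      Tendsto γ atTop (𝓝 0) → ¬ Summable γ → CauchySeq W → ‖Q (Y 0 + W 0) - x‖ < r →
      Tendsto (fun n => Q (Y n + W n)) atTop (𝓝 x) := by
  obtain ⟨r, hr, θ, hθ, hstay⟩ := h.exists_forall_norm_sub_le h.R_pos le_rfl
  refine ⟨r, hr, θ, hθ, fun γ Y W o hγ hγs hW hstart => Metric.tendsto_atTop'.2 fun ε hε => ?_⟩
  obtain ⟨r', hr', θ', hθ', hstay'⟩ := h.exists_forall_norm_sub_le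
    (lt_min (half_pos hε) h.R_pos) (min_le_right _ _)
  obtain ⟨M, hnear, o'⟩ := ((h.frequently_norm_sub_lt o hγ hγs hW (hstay γ Y W o hstart)
    hr').and_eventually (o.eventually_shift hγ hW hθ')).exists
  refine ⟨M, fun n hn => ?_⟩
  have hclose := hstay' _ _ _ o' (by simpa using hnear) (n - M)
  simp only [Nat.sub_add_cancel hn.le, add_add_sub_cancel] at hclose
  rw [dist_eq_norm]
  exact (hclose.trans (min_le_left _ _)).trans_lt (half_lt_self hε)

end Convergence

end IsDualAveraging

/-! ### Martingale noise -/

/-- A square-integrable martingale-difference sequence: `d n` is revealed at time `n + 1` and has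
zero mean conditionally on time `n`. -/
structure IsMartingaleDiff {Ω E : Type*} {m0 : MeasurableSpace Ω} [NormedAddCommGroup E]
    [NormedSpace ℝ E] [CompleteSpace E] (ℱ : Filtration ℕ m0) (P : Measure Ω)
    (d : ℕ → Ω → E) : Prop where
  stronglyMeasurable : ∀ n, StronglyMeasurable[ℱ (n + 1)] (d n)
  memLp : ∀ n, MemLp (d n) 2 P
  condExp_eq_zero : ∀ n, P[d n | ℱ n] =ᵐ[P] 0

namespace IsMartingaleDiff

section Banach

variable {Ω E F : Type*} {m0 : MeasurableSpace Ω} {P : Measure Ω} {ℱ : Filtration ℕ m0}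
  [NormedAddCommGroup E] [NormedSpace ℝ E] [CompleteSpace E] [NormedAddCommGroup F]
  [NormedSpace ℝ F] [CompleteSpace F] {d : ℕ → Ω → E}

theorem const_smul (h : IsMartingaleDiff ℱ P d) (c : ℕ → ℝ) :
    IsMartingaleDiff ℱ P fun n => c n • d n where
  stronglyMeasurable n := (h.stronglyMeasurable n).const_smul (c n)
  memLp n := (h.memLp n).const_smul (c n)
  condExp_eq_zero n := by
    filter_upwards [condExp_smul (μ := P) (c n) (d n) (ℱ n), h.condExp_eq_zero n] with ω hsmul hω
    rw [hsmul, Pi.smul_apply, hω, Pi.zero_apply, smul_zero]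

theorem shift (h : IsMartingaleDiff ℱ P d) (m : ℕ) :
    IsMartingaleDiff ⟨fun n => ℱ (n + m), fun _ _ hij => ℱ.mono (Nat.add_le_add_right hij m),
      fun n => ℱ.le (n + m)⟩ P fun n => d (n + m) where
  stronglyMeasurable n := by
    change StronglyMeasurable[ℱ (n + 1 + m)] (d (n + m))
    rw [add_right_comm]
    exact h.stronglyMeasurable (n + m)
  memLp n := h.memLp (n + m)
  condExp_eq_zero n := h.condExp_eq_zero (n + m)

theorem stronglyMeasurable_sum (h : IsMartingaleDiff ℱ P d) (n : ℕ) :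
    StronglyMeasurable[ℱ n] fun ω => ∑ k ∈ Finset.range n, d k ω :=
  Finset.stronglyMeasurable_fun_sum _ fun k hk =>
    (h.stronglyMeasurable k).mono (ℱ.mono (Nat.succ_le_of_lt (Finset.mem_range.1 hk)))

theorem memLp_sum (h : IsMartingaleDiff ℱ P d) (n : ℕ) :
    MemLp (fun ω => ∑ k ∈ Finset.range n, d k ω) 2 P :=
  memLp_finsetSum _ fun k _ => h.memLp k

variable [IsFiniteMeasure P]

theorem integrable (h : IsMartingaleDiff ℱ P d) (n : ℕ) : Integrable (d n) P :=
  (h.memLp n).integrable one_le_two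

theorem map (h : IsMartingaleDiff ℱ P d) (L : E →L[ℝ] F) :
    IsMartingaleDiff ℱ P fun n ω => L (d n ω) where
  stronglyMeasurable n := L.continuous.comp_stronglyMeasurable (h.stronglyMeasurable n)
  memLp n := L.comp_memLp' (h.memLp n)
  condExp_eq_zero n := by
    filter_upwards [L.comp_condExp_comm (h.integrable n) (m := ℱ n), h.condExp_eq_zero n]
      with ω hmap hω
    rw [← Function.comp_def L, ← hmap, Function.comp_apply, hω, Pi.zero_apply, map_zero,
      Pi.zero_apply]

theorem indicator (h : IsMartingaleDiff ℱ P d) {A : Set Ω} (hA : MeasurableSet[ℱ 0] A) :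
    IsMartingaleDiff ℱ P fun n => A.indicator (d n) where
  stronglyMeasurable n := (h.stronglyMeasurable n).indicator (ℱ.mono (Nat.zero_le _) A hA)
  memLp n := (h.memLp n).indicator (ℱ.le 0 A hA)
  condExp_eq_zero n := by
    filter_upwards [condExp_indicator (h.integrable n) (ℱ.mono (Nat.zero_le n) A hA),
      h.condExp_eq_zero n] with ω hind hω
    by_cases hωA : ω ∈ A
    · rw [hind, Set.indicator_of_mem hωA, hω]
    · rw [hind, Set.indicator_of_notMem hωA, Pi.zero_apply]

theorem martingale_sum (h : IsMartingaleDiff ℱ P d) :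
    Martingale (fun n ω => ∑ k ∈ Finset.range n, d k ω) ℱ P := by
  refine martingale_of_condExp_sub_eq_zero_nat h.stronglyMeasurable_sum
    (fun n => (h.memLp_sum n).integrable one_le_two) fun n => ?_
  rw [show ((fun ω => ∑ k ∈ Finset.range (n + 1), d k ω) -
      fun ω => ∑ k ∈ Finset.range n, d k ω) = d n from
    funext fun ω => by rw [Pi.sub_apply, Finset.sum_range_succ, add_sub_cancel_left]]
  exact h.condExp_eq_zero n

theorem submartingale_norm_sq_sum (h : IsMartingaleDiff ℱ P d) :
    Submartingale (fun n ω => ‖∑ k ∈ Finset.range n, d k ω‖ ^ 2) ℱ P := by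
  have hint (n : ℕ) : Integrable (fun ω => ‖∑ k ∈ Finset.range n, d k ω‖ ^ 2) P :=
    (h.memLp_sum n).integrable_norm_pow two_ne_zero
  refine submartingale_nat (fun n => (h.stronglyMeasurable_sum n).norm.pow 2) hint fun n => ?_
  have hconvex : ConvexOn ℝ Set.univ fun z : E => ‖z‖ ^ 2 :=
    convexOn_univ_norm.pow (fun z _ => norm_nonneg z) 2
  have hcont : Continuous fun z : E => ‖z‖ ^ 2 := by fun_prop
  filter_upwards [hconvex.map_condExp_le_univ (ℱ.le n) hcont.lowerSemicontinuous
    (h.martingale_sum.integrable (n + 1)) (hint (n + 1)),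
    h.martingale_sum.condExp_ae_eq n.le_succ] with ω hjensen hmart
  rw [Function.comp_apply, hmart] at hjensen
  exact hjensen

end Banach

section Hilbert

variable {Ω H : Type*} {m0 : MeasurableSpace Ω} {P : Measure Ω}
  {ℱ : Filtration ℕ m0} [NormedAddCommGroup H] [InnerProductSpace ℝ H] [CompleteSpace H]
  {d : ℕ → Ω → H} {v : ℝ}

theorem integrable_inner_sum (h : IsMartingaleDiff ℱ P d) (n : ℕ) :
    Integrable (fun ω => inner ℝ (∑ k ∈ Finset.range n, d k ω) (d n ω)) P := by
  refine ((h.memLp_sum n).norm.integrable_mul (h.memLp n).norm).mono'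
    ((h.memLp_sum n).1.inner (h.memLp n).1) (ae_of_all _ fun ω => ?_)
  exact abs_real_inner_le_norm _ _

variable [IsFiniteMeasure P]

theorem integral_inner_sum_eq_zero (h : IsMartingaleDiff ℱ P d) (n : ℕ) :
    ∫ ω, inner ℝ (∑ k ∈ Finset.range n, d k ω) (d n ω) ∂P = 0 := by
  have hpull := condExp_bilin_of_stronglyMeasurable_left (innerSL ℝ)
    (h.stronglyMeasurable_sum n) (h.integrable_inner_sum n) (h.integrable n)
  rw [← integral_condExp (ℱ.le n)]
  refine integral_eq_zero_of_ae (hpull.trans ?_)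
  filter_upwards [h.condExp_eq_zero n] with ω hω
  rw [hω, Pi.zero_apply, map_zero, Pi.zero_apply]

theorem integral_norm_sq_sum (h : IsMartingaleDiff ℱ P d) (n : ℕ) :
    ∫ ω, ‖∑ k ∈ Finset.range n, d k ω‖ ^ 2 ∂P =
      ∑ k ∈ Finset.range n, ∫ ω, ‖d k ω‖ ^ 2 ∂P := by
  induction n with
  | zero => simp
  | succ n ih =>
    have hsum := (h.memLp_sum n).integrable_norm_pow two_ne_zero
    have hinner := (h.integrable_inner_sum n).const_mul 2
    simp_rw [Finset.sum_range_succ, norm_add_sq_real]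
    rw [integral_add (f := fun ω => ‖∑ k ∈ Finset.range n, d k ω‖ ^ 2 +
        2 * inner ℝ (∑ k ∈ Finset.range n, d k ω) (d n ω)) (hsum.add hinner)
      ((h.memLp n).integrable_norm_pow two_ne_zero), integral_add hsum hinner, integral_const_mul,
      h.integral_inner_sum_eq_zero, ih]
    ring

theorem measure_exists_le_norm_sum_le (h : IsMartingaleDiff ℱ P d)
    (hv : ∀ n, ∑ k ∈ Finset.range n, ∫ ω, ‖d k ω‖ ^ 2 ∂P ≤ v) {w : ℝ} (hw : 0 < w) :
    P {ω | ∃ n, w ≤ ‖∑ k ∈ Finset.range n, d k ω‖} ≤ ENNReal.ofReal (v / w ^ 2) := by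
  have hsub := h.submartingale_norm_sq_sum
  set S : ℕ → Ω → ℝ := fun n ω => ‖∑ k ∈ Finset.range n, d k ω‖ ^ 2
  have hS0 : 0 ≤ S := fun n ω => sq_nonneg _
  set B : ℕ → Set Ω := fun n => {ω | ((w ^ 2).toNNReal : ℝ) ≤
    (Finset.range (n + 1)).sup' Finset.nonempty_range_add_one fun k => S k ω} with hB
  have hBmono : Monotone B := fun n k hnk ω hω =>
    le_trans (Set.mem_ofPred_eq ▸ hω) (Finset.sup'_mono _ (Finset.range_mono (by omega)) _)
  have hBle (n : ℕ) : P (B n) ≤ ENNReal.ofReal (v / w ^ 2) := by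
    have hdoob := (maximal_ineq hsub hS0 (ε := (w ^ 2).toNNReal) n).trans
      (ENNReal.ofReal_le_ofReal ((setIntegral_le_integral (hsub.integrable n)
        (ae_of_all _ (hS0 n))).trans ((h.integral_norm_sq_sum n).trans_le (hv n))))
    rw [ENNReal.ofReal_div_of_pos (by positivity)]
    refine (ENNReal.le_div_iff_mul_le (Or.inl ?_) (Or.inl ENNReal.ofReal_ne_top)).2 ?_
    · exact (ENNReal.ofReal_pos.2 (by positivity)).ne'
    · rwa [mul_comm]
  calc P {ω | ∃ n, w ≤ ‖∑ k ∈ Finset.range n, d k ω‖}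
      ≤ P (⋃ n, B n) := measure_mono fun ω ⟨n, hn⟩ => Set.mem_iUnion.2 ⟨n, by
        rw [hB, Set.mem_ofPred_eq, Real.coe_toNNReal _ (sq_nonneg w)]
        exact (pow_le_pow_left₀ hw.le hn 2).trans
          (Finset.le_sup' (fun k => S k ω) (Finset.self_mem_range_succ n))⟩
    _ = ⨆ n, P (B n) := hBmono.measure_iUnion
    _ ≤ ENNReal.ofReal (v / w ^ 2) := iSup_le hBle

theorem ae_cauchySeq_sum (h : IsMartingaleDiff ℱ P d)
    (hd : Summable fun n => ∫ ω, ‖d n ω‖ ^ 2 ∂P) :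
    ∀ᵐ ω ∂P, CauchySeq fun n => ∑ k ∈ Finset.range n, d k ω := by
  have htail (j : ℕ) : ∀ᵐ ω ∂P, ∃ m, ∀ n,
      ‖∑ k ∈ Finset.range n, d (k + m) ω‖ < 1 / ((j : ℝ) + 1) := by
    have hlim : Tendsto (fun m => ENNReal.ofReal
        ((∑' k, ∫ ω, ‖d (k + m) ω‖ ^ 2 ∂P) / (1 / ((j : ℝ) + 1)) ^ 2)) atTop (𝓝 0) := by
      simpa only [zero_div, ENNReal.ofReal_zero] using ENNReal.tendsto_ofReal
        ((tendsto_sum_nat_add fun n => ∫ ω, ‖d n ω‖ ^ 2 ∂P).div_const ((1 / ((j : ℝ) + 1)) ^ 2))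
    refine le_antisymm (ge_of_tendsto' hlim fun m => (measure_mono fun ω hω => ?_).trans
      ((h.shift m).measure_exists_le_norm_sum_le (fun n => ?_) (by positivity))) zero_le
    · simpa using not_exists.1 hω m
    · exact ((summable_nat_add_iff m).2 hd).sum_le_tsum _ fun k _ =>
        integral_nonneg fun ω => sq_nonneg _
  filter_upwards [ae_all_iff.2 htail] with ω hω
  refine Metric.cauchySeq_iff'.2 fun ε hε => ?_
  obtain ⟨j, hj⟩ := exists_nat_one_div_lt hε
  obtain ⟨m, hm⟩ := hω j
  refine ⟨m, fun n hn => ?_⟩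
  obtain ⟨n, rfl⟩ := Nat.exists_eq_add_of_le' hn
  rw [dist_eq_norm, add_comm, Finset.sum_range_add, add_sub_cancel_left]
  simpa only [add_comm m] using (hm n).trans hj

end Hilbert

end IsMartingaleDiff

theorem exists_continuousLinearMap_norm_le (E : Type*) [NormedAddCommGroup E] [NormedSpace ℝ E]
    [FiniteDimensional ℝ E] :
    ∃ L : E →L[ℝ] EuclideanSpace ℝ (Fin (Module.finrank ℝ E)), ∀ z, ‖z‖ ≤ ‖L z‖ := by
  let e : E ≃L[ℝ] EuclideanSpace ℝ (Fin (Module.finrank ℝ E)) := toEuclidean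
  refine ⟨‖(e.symm : EuclideanSpace ℝ (Fin (Module.finrank ℝ E)) →L[ℝ] E)‖ •
    (e : E →L[ℝ] EuclideanSpace ℝ (Fin (Module.finrank ℝ E))), fun z => ?_⟩
  rw [smul_apply, norm_smul, norm_norm]
  simpa using (e.symm : EuclideanSpace ℝ (Fin (Module.finrank ℝ E)) →L[ℝ] E).le_opNorm (e z)

theorem setIntegral_le_of_condExp_le {Ω : Type*} {m m0 : MeasurableSpace Ω} {P : Measure Ω}
    [IsFiniteMeasure P] (hm : m ≤ m0) {g : Ω → ℝ} {s : ℝ} (hg : Integrable g P)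
    (hs : P[g | m] ≤ᵐ[P] fun _ => s) {A : Set Ω} (hA : MeasurableSet[m] A) :
    ∫ ω in A, g ω ∂P ≤ s * P.real A := by
  rw [← setIntegral_condExp hm hg hA]
  refine (setIntegral_mono_ae integrable_condExp.integrableOn (integrable_const s).integrableOn
    hs).trans_eq ?_
  rw [setIntegral_const, smul_eq_mul, mul_comm]

theorem one_sub_le_cond_real {Ω : Type*} {m0 : MeasurableSpace Ω} {P : Measure Ω}
    [IsFiniteMeasure P] {A T : Set Ω} (hA : MeasurableSet A) (hPA : P A ≠ 0) {ε : ℝ} (hε : 0 ≤ ε)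
    (hT : P (A ∩ Tᶜ) ≤ ENNReal.ofReal (ε * P.real A)) : 1 - ε ≤ (cond P A).real T := by
  have : IsProbabilityMeasure (cond P A) := cond_isProbabilityMeasure hPA
  have hPA' : 0 < P.real A := ENNReal.toReal_pos hPA (measure_ne_top P A)
  have hcompl : (cond P A).real Tᶜ ≤ ε := by
    rw [measureReal_def, cond_apply hA, ENNReal.toReal_mul, ENNReal.toReal_inv, ← measureReal_def,
      inv_mul_le_iff₀ hPA', mul_comm]
    exact ENNReal.toReal_le_of_le_ofReal (by positivity) hT
  have hcover : 1 ≤ (cond P A).real T + (cond P A).real Tᶜ := by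
    rw [← probReal_univ (μ := cond P A), ← Set.union_compl_self T]
    exact measureReal_union_le T Tᶜ
  linarith

namespace IsMartingaleDiff

variable {Ω E H : Type*} {m0 : MeasurableSpace Ω} {P : Measure Ω} [IsFiniteMeasure P]
  {ℱ : Filtration ℕ m0} [NormedAddCommGroup E] [NormedSpace ℝ E] [CompleteSpace E]
  [NormedAddCommGroup H] [InnerProductSpace ℝ H] {Z : ℕ → Ω → E}
  {σ : ℝ}

theorem integral_norm_sq_indicator_smul_le (h : IsMartingaleDiff ℱ P Z)
    (hσ : ∀ n, P[fun ω => ‖Z n ω‖ ^ 2 | ℱ n] ≤ᵐ[P] fun _ => σ ^ 2) (L : E →L[ℝ] H) (γ : ℕ → ℝ)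
    {A : Set Ω} (hA : MeasurableSet[ℱ 0] A) (n : ℕ) :
    ∫ ω, ‖A.indicator (fun ω => L ((γ n • Z n) ω)) ω‖ ^ 2 ∂P ≤
      ‖L‖ ^ 2 * σ ^ 2 * P.real A * γ n ^ 2 := by
  have hZ : Integrable (fun ω => ‖Z n ω‖ ^ 2) P := (h.memLp n).integrable_norm_pow two_ne_zero
  have hpoint (ω : Ω) : ‖L ((γ n • Z n) ω)‖ ^ 2 ≤ ‖L‖ ^ 2 * γ n ^ 2 * ‖Z n ω‖ ^ 2 := by
    rw [← sq_abs (γ n), ← Real.norm_eq_abs, ← mul_pow, ← mul_pow, mul_assoc, ← norm_smul]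
    exact pow_le_pow_left₀ (norm_nonneg _) (L.le_opNorm _) 2
  calc ∫ ω, ‖A.indicator (fun ω => L ((γ n • Z n) ω)) ω‖ ^ 2 ∂P
      = ∫ ω in A, ‖L ((γ n • Z n) ω)‖ ^ 2 ∂P := by
        rw [← integral_indicator (ℱ.le 0 A hA)]
        refine integral_congr_ae (ae_of_all _ fun ω => ?_)
        by_cases hω : ω ∈ A
        · simp only [Set.indicator_of_mem hω]
        · simp only [Set.indicator_of_notMem hω, norm_zero, zero_pow two_ne_zero]
    _ ≤ ∫ ω in A, ‖L‖ ^ 2 * γ n ^ 2 * ‖Z n ω‖ ^ 2 ∂P :=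
        integral_mono_of_nonneg (ae_of_all _ fun ω => sq_nonneg _)
          (hZ.const_mul _).integrableOn (ae_of_all _ hpoint)
    _ ≤ ‖L‖ ^ 2 * γ n ^ 2 * (σ ^ 2 * P.real A) := by
        rw [integral_const_mul]
        gcongr
        exact setIntegral_le_of_condExp_le (ℱ.le n) hZ (hσ n) (ℱ.mono (Nat.zero_le n) A hA)
    _ = ‖L‖ ^ 2 * σ ^ 2 * P.real A * γ n ^ 2 := by ring

variable [CompleteSpace H] {L : E →L[ℝ] H} {γ : ℕ → ℝ}

theorem ae_cauchySeq_sum_smul (h : IsMartingaleDiff ℱ P Z)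
    (hσ : ∀ n, P[fun ω => ‖Z n ω‖ ^ 2 | ℱ n] ≤ᵐ[P] fun _ => σ ^ 2) (hL : ∀ z, ‖z‖ ≤ ‖L z‖)
    (hγ : Summable fun n => γ n ^ 2) :
    ∀ᵐ ω ∂P, CauchySeq fun n => ∑ k ∈ Finset.range n, γ k • Z k ω := by
  have hsummable : Summable fun n => ∫ ω, ‖L ((γ n • Z n) ω)‖ ^ 2 ∂P :=
    (hγ.mul_left _).of_nonneg_of_le (fun n => integral_nonneg fun ω => sq_nonneg _) fun n => by
      simpa only [Set.indicator_univ] using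
        h.integral_norm_sq_indicator_smul_le hσ L γ MeasurableSet.univ n
  filter_upwards [((h.const_smul γ).map L).ae_cauchySeq_sum hsummable] with ω hω
  simp only [Pi.smul_apply, ← map_sum] at hω
  refine Metric.cauchySeq_iff.2 fun ε hε => ?_
  obtain ⟨N, hN⟩ := Metric.cauchySeq_iff.1 hω ε hε
  refine ⟨N, fun a ha b hb => lt_of_le_of_lt ?_ (hN a ha b hb)⟩
  rw [dist_eq_norm, dist_eq_norm, ← map_sub]
  exact hL _

theorem measure_inter_exists_le_norm_sum_smul_le (h : IsMartingaleDiff ℱ P Z)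
    (hσ : ∀ n, P[fun ω => ‖Z n ω‖ ^ 2 | ℱ n] ≤ᵐ[P] fun _ => σ ^ 2) (hL : ∀ z, ‖z‖ ≤ ‖L z‖)
    (hγ : Summable fun n => γ n ^ 2) {A : Set Ω} (hA : MeasurableSet[ℱ 0] A) {w ε : ℝ}
    (hw : 0 < w) (hε : ‖L‖ ^ 2 * σ ^ 2 * ∑' n, γ n ^ 2 ≤ ε * w ^ 2) :
    P (A ∩ {ω | ∃ n, w ≤ ‖∑ k ∈ Finset.range n, γ k • Z k ω‖}) ≤
      ENNReal.ofReal (ε * P.real A) := by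
  have hbound := (((h.const_smul γ).map L).indicator hA).measure_exists_le_norm_sum_le
    (v := ε * w ^ 2 * P.real A) (fun n => ?_) hw
  · rw [mul_right_comm, mul_div_cancel_right₀ _ (by positivity)] at hbound
    refine (measure_mono fun ω hω => ?_).trans hbound
    obtain ⟨hωA, n, hn⟩ := hω
    refine ⟨n, (hn.trans (hL _)).trans_eq ?_⟩
    simp only [Set.indicator_of_mem hωA, Pi.smul_apply, map_sum]
  · calc ∑ k ∈ Finset.range n, ∫ ω, ‖A.indicator (fun ω => L ((γ k • Z k) ω)) ω‖ ^ 2 ∂P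
        ≤ ‖L‖ ^ 2 * σ ^ 2 * P.real A * ∑ k ∈ Finset.range n, γ k ^ 2 := by
          rw [Finset.mul_sum]
          exact Finset.sum_le_sum fun k _ => h.integral_norm_sq_indicator_smul_le hσ L γ hA k
      _ ≤ ‖L‖ ^ 2 * σ ^ 2 * P.real A * ∑' k, γ k ^ 2 := by
          gcongr
          exact hγ.sum_le_tsum _ fun _ _ => sq_nonneg _
      _ = ‖L‖ ^ 2 * σ ^ 2 * (∑' k, γ k ^ 2) * P.real A := by ring
      _ ≤ ε * w ^ 2 * P.real A := by gcongr

end IsMartingaleDiff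

/-- A run of dual averaging along `V` in which the field is observed with a square-integrable
martingale-difference noise of conditional second moment at most `σ ^ 2`. -/
structure IsStochasticRun {Ω E F : Type*} {m0 : MeasurableSpace Ω} [NormedAddCommGroup F]
    [NormedSpace ℝ F] [CompleteSpace F] (Q : F → E) (V : E → F) (ℱ : Filtration ℕ m0)
    (P : Measure Ω) (γ : ℕ → ℝ) (σ : ℝ) (Y Z : ℕ → Ω → F) : Prop where
  noise : IsMartingaleDiff ℱ P Z
  second_moment : ∀ n, P[fun ω => ‖Z n ω‖ ^ 2 | ℱ n] ≤ᵐ[P] fun _ => σ ^ 2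
  update : ∀ n ω, Y (n + 1) ω = Y n ω + γ n • (V (Q (Y n ω)) + Z n ω)

/-- Subtracting the accumulated noise from the scores turns it into a perturbation of the point at
which the field is evaluated. -/
theorem IsStochasticRun.isPerturbedOrbit {Ω E F : Type*} {m0 : MeasurableSpace Ω}
    [NormedAddCommGroup F] [NormedSpace ℝ F] [CompleteSpace F] {Q : F → E} {V : E → F}
    {ℱ : Filtration ℕ m0} {P : Measure Ω} {γ : ℕ → ℝ} {σ θ : ℝ} {Y Z : ℕ → Ω → F}
    (h : IsStochasticRun Q V ℱ P γ σ Y Z) (hγ : ∀ n, 0 < γ n) (hγθ : ∀ n, γ n ≤ θ) {ω : Ω}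
    (hω : ∀ n, ‖∑ k ∈ Finset.range n, γ k • Z k ω‖ ≤ θ) :
    IsPerturbedOrbit Q V θ γ (fun n => Y n ω - ∑ k ∈ Finset.range n, γ k • Z k ω)
      fun n => ∑ k ∈ Finset.range n, γ k • Z k ω where
  step_pos := hγ
  step_le := hγθ
  norm_le := hω
  update n := by
    rw [sub_add_cancel, h.update, Finset.sum_range_succ, smul_add]
    abel

theorem IsDualAveraging.exists_forall_le_cond_tendsto {E F : Type*} [NormedAddCommGroup E]
    [NormedSpace ℝ E] [FiniteDimensional ℝ E] [NormedAddCommGroup F] [NormedSpace ℝ F]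
    [FiniteDimensional ℝ F] [CompleteSpace F] {p : E →L[ℝ] F →L[ℝ] ℝ} {f : F → ℝ} {Q : F → E}
    {V : E → F} {x : E} {κ c C R : ℝ} (h : IsDualAveraging p f Q V x κ c C R) :
    ∃ r > 0, ∀ σ : ℝ, ∀ ε > 0, ∃ δ > 0, ∀ γ : ℕ → ℝ, (∀ n, 0 < γ n) → ¬ Summable γ →
      (Summable fun n => γ n ^ 2) → ∑' n, γ n ^ 2 ≤ δ →
      ∀ (Ω : Type*) [MeasurableSpace Ω] (P : Measure Ω) [IsFiniteMeasure P]
        (ℱ : Filtration ℕ ‹MeasurableSpace Ω›) (Y Z : ℕ → Ω → F),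
        IsStochasticRun Q V ℱ P γ σ Y Z →
        MeasurableSet[ℱ 0] {ω | ‖Q (Y 0 ω) - x‖ < r} → P {ω | ‖Q (Y 0 ω) - x‖ < r} ≠ 0 →
        1 - ε ≤ (cond P {ω | ‖Q (Y 0 ω) - x‖ < r}).real
          {ω | Tendsto (fun n => Q (Y n ω)) atTop (𝓝 x)} := by
  obtain ⟨r, hr, θ, hθ, hconv⟩ := h.exists_forall_tendsto
  obtain ⟨L, hL⟩ := exists_continuousLinearMap_norm_le F
  refine ⟨r, hr, fun σ ε hε => ⟨min (θ ^ 2) (ε * θ ^ 2 / (‖L‖ ^ 2 * σ ^ 2 + 1)), by positivity,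
    fun γ hγ hγs hγ2 hδ Ω _ P _ ℱ Y Z run hA hPA => ?_⟩⟩
  set A := {ω | ‖Q (Y 0 ω) - x‖ < r}
  have hstep (n : ℕ) : γ n ≤ θ := (sq_le_sq₀ (hγ n).le hθ.le).1
    ((hγ2.le_tsum n fun _ _ => sq_nonneg _).trans (hδ.trans (min_le_left _ _)))
  have hγ0 : Tendsto γ atTop (𝓝 0) := by
    simpa [Real.sqrt_sq (hγ _).le] using (hγ2.tendsto_atTop_zero).sqrt
  have hfail : ∀ᵐ ω ∂P, ω ∈ A ∩ {ω | Tendsto (fun n => Q (Y n ω)) atTop (𝓝 x)}ᶜ →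
      ω ∈ A ∩ {ω | ∃ n, θ ≤ ‖∑ k ∈ Finset.range n, γ k • Z k ω‖} := by
    filter_upwards [run.noise.ae_cauchySeq_sum_smul run.second_moment hL hγ2]
      with ω hcauchy ⟨hωA, hω⟩
    refine ⟨hωA, by_contra fun hsmall => hω ?_⟩
    have hθ' (n : ℕ) : ‖∑ k ∈ Finset.range n, γ k • Z k ω‖ ≤ θ :=
      (not_le.1 fun hn => hsmall ⟨n, hn⟩).le
    simpa only [Set.mem_ofPred_eq, sub_add_cancel] using
      hconv γ _ _ (run.isPerturbedOrbit hγ hstep hθ') hγ0 hγs hcauchy (by simpa [A] using hωA)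
  refine one_sub_le_cond_real (ℱ.le 0 A hA) hPA hε.le ((measure_mono_ae hfail).trans
    (run.noise.measure_inter_exists_le_norm_sum_smul_le run.second_moment hL hγ2 hA hθ ?_))
  have hnoise := (le_div_iff₀ (by positivity)).1 (hδ.trans (min_le_right _ _))
  have hsum : 0 ≤ ∑' n, γ n ^ 2 := tsum_nonneg fun _ => sq_nonneg _
  linarith

/-! ### Klein's inequality and the matrix softmax -/

section SpectralOverlap

variable {n 𝕜 : Type*} [RCLike 𝕜] [Fintype n] [DecidableEq n] {A B : Matrix n n 𝕜}

/-- The squared modulus of the inner product of the `i`-th eigenvector of `A` with the `j`-th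
eigenvector of `B`. These weights turn traces of products of functions of `A` and `B` into double
sums over the two spectra. -/
noncomputable def spectralOverlap (hA : A.IsHermitian) (hB : B.IsHermitian) (i j : n) : ℝ :=
  RCLike.normSq ((star (hA.eigenvectorUnitary : Matrix n n 𝕜) * hB.eigenvectorUnitary) i j)

theorem spectralOverlap_nonneg (hA : A.IsHermitian) (hB : B.IsHermitian) (i j : n) :
    0 ≤ spectralOverlap hA hB i j :=
  RCLike.normSq_nonneg _

theorem re_trace_cfc_mul_cfc (hA : A.IsHermitian) (hB : B.IsHermitian) (f g : ℝ → ℝ) :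
    RCLike.re (cfc f A * cfc g B).trace =
      ∑ i, ∑ j, spectralOverlap hA hB i j * (f (hA.eigenvalues i) * g (hB.eigenvalues j)) := by
  set U : Matrix n n 𝕜 := ↑hA.eigenvectorUnitary with hU
  set W : Matrix n n 𝕜 := ↑hB.eigenvectorUnitary with hW
  set a : n → 𝕜 := RCLike.ofReal ∘ f ∘ hA.eigenvalues with ha
  set b : n → 𝕜 := RCLike.ofReal ∘ g ∘ hB.eigenvalues with hb
  have htrace : (cfc f A * cfc g B).trace =
      (Matrix.diagonal a * (star U * W * Matrix.diagonal b * star (star U * W))).trace := by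
    have hfA : cfc f A = U * (Matrix.diagonal a * star U) := by
      rw [hA.cfc_eq, Matrix.IsHermitian.cfc, Unitary.conjStarAlgAut_apply, mul_assoc]
    have hgB : cfc g B = W * Matrix.diagonal b * star W := by
      rw [hB.cfc_eq, Matrix.IsHermitian.cfc, Unitary.conjStarAlgAut_apply]
    rw [hfA, hgB, mul_assoc, Matrix.trace_mul_comm]
    simp only [star_mul, star_star, mul_assoc]
  have hentry : ∀ i j, a i * ((star U * W) i j * b j * star ((star U * W) i j)) =
      ((spectralOverlap hA hB i j * (f (hA.eigenvalues i) * g (hB.eigenvalues j)) : ℝ) : 𝕜) := by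
    intro i j
    have hnorm := RCLike.mul_conj ((star U * W) i j)
    simp only [spectralOverlap, RCLike.normSq_eq_def', ← hU, ← hW, ha, hb, Function.comp_apply,
      RCLike.ofReal_mul, RCLike.ofReal_pow, ← hnorm, RCLike.star_def]
    ring
  rw [htrace, Matrix.trace]
  simp only [Matrix.diag_apply, Matrix.diagonal_mul, Matrix.mul_apply (N := star (star U * W)),
    Matrix.mul_diagonal, Matrix.star_apply, Finset.mul_sum, hentry, map_sum, RCLike.ofReal_re]

theorem re_trace_cfc (hA : A.IsHermitian) (f : ℝ → ℝ) :
    RCLike.re (cfc f A).trace = ∑ i, f (hA.eigenvalues i) := by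
  rw [hA.cfc_eq, Matrix.IsHermitian.cfc, Unitary.conjStarAlgAut_apply, Matrix.trace_mul_comm,
    ← mul_assoc, Unitary.coe_star_mul_self, one_mul, Matrix.trace_diagonal, map_sum]
  simp only [Function.comp_apply, RCLike.ofReal_re]

theorem re_trace_mul_nonpos (hA : A.PosSemidef) (hB : B.IsHermitian)
    (hB0 : ∀ j, hB.eigenvalues j ≤ 0) : RCLike.re (A * B).trace ≤ 0 := by
  have hAsa : IsSelfAdjoint A := hA.isHermitian
  have hBsa : IsSelfAdjoint B := hB
  have htrace := re_trace_cfc_mul_cfc hA.isHermitian hB id id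
  rw [cfc_id ℝ A, cfc_id ℝ B] at htrace
  rw [htrace]
  exact Finset.sum_nonpos fun i _ => Finset.sum_nonpos fun j _ =>
    mul_nonpos_of_nonneg_of_nonpos (spectralOverlap_nonneg _ _ i j)
      (mul_nonpos_of_nonneg_of_nonpos (hA.eigenvalues_nonneg i) (hB0 j))

theorem exp_sub_exp_add_sq_le {s t : ℝ} (hs : s ≤ 0) (ht : t ≤ 0) :
    Real.exp s - Real.exp t + 1 / 4 * (Real.exp s - Real.exp t) ^ 2 ≤ Real.exp s * (s - t) := by
  have hs_sq : Real.exp s = Real.exp (s / 2) ^ 2 := by rw [← Real.exp_nat_mul]; congr 1; ring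
  have ht_sq : Real.exp t = Real.exp (t / 2) ^ 2 := by rw [← Real.exp_nat_mul]; congr 1; ring
  have hratio : Real.exp (s / 2) * Real.exp ((t - s) / 2) = Real.exp (t / 2) := by
    rw [← Real.exp_add]; congr 1; ring
  have htangent : Real.exp (s / 2) * ((t - s) / 2 + 1) ≤ Real.exp (t / 2) :=
    hratio ▸ mul_le_mul_of_nonneg_left (Real.add_one_le_exp _) (Real.exp_pos _).le
  have hsum : (Real.exp (s / 2) + Real.exp (t / 2)) ^ 2 ≤ 2 ^ 2 := by
    have hu : Real.exp (s / 2) ≤ 1 := Real.exp_le_one_iff.2 (by linarith)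
    have hv : Real.exp (t / 2) ≤ 1 := Real.exp_le_one_iff.2 (by linarith)
    exact pow_le_pow_left₀ (by positivity) (by linarith) 2
  rw [hs_sq, ht_sq]
  nlinarith [mul_le_mul_of_nonneg_left htangent (Real.exp_pos (s / 2)).le,
    mul_le_mul_of_nonneg_right hsum (sq_nonneg (Real.exp (s / 2) - Real.exp (t / 2)))]

theorem klein_trace_inequality (hA : A.IsHermitian) (hB : B.IsHermitian)
    (hA0 : ∀ i, hA.eigenvalues i ≤ 0) (hB0 : ∀ j, hB.eigenvalues j ≤ 0) :
    RCLike.re (cfc Real.exp A).trace - RCLike.re (cfc Real.exp B).trace +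
      1 / 4 * RCLike.re ((cfc Real.exp A - cfc Real.exp B) *
        (cfc Real.exp A - cfc Real.exp B)).trace ≤
      RCLike.re (cfc Real.exp A * (A - B)).trace := by
  have hAsa : IsSelfAdjoint A := hA
  have hBsa : IsSelfAdjoint B := hB
  have hexpA := re_trace_cfc_mul_cfc hA hB Real.exp 1
  have hexpB := re_trace_cfc_mul_cfc hA hB 1 Real.exp
  have hsqA := re_trace_cfc_mul_cfc hA hB (fun s => Real.exp s * Real.exp s) 1
  have hsqB := re_trace_cfc_mul_cfc hA hB 1 (fun t => Real.exp t * Real.exp t)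
  have hmix := re_trace_cfc_mul_cfc hA hB Real.exp Real.exp
  have hlinA := re_trace_cfc_mul_cfc hA hB (fun s => Real.exp s * id s) 1
  have hlinB := re_trace_cfc_mul_cfc hA hB Real.exp id
  rw [cfc_one ℝ B, mul_one] at hexpA hsqA hlinA
  rw [cfc_one ℝ A, one_mul] at hexpB hsqB
  rw [cfc_mul Real.exp Real.exp A] at hsqA
  rw [cfc_mul Real.exp Real.exp B] at hsqB
  rw [cfc_mul Real.exp id A, cfc_id ℝ A] at hlinA
  rw [cfc_id ℝ B] at hlinB
  have hcomm := Matrix.trace_mul_comm (cfc Real.exp B) (cfc Real.exp A)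
  simp only [mul_sub, sub_mul, Matrix.trace_sub, map_sub, hcomm, hexpA, hexpB, hsqA, hsqB, hmix,
    hlinA, hlinB, ← Finset.sum_sub_distrib, ← Finset.sum_add_distrib, Finset.mul_sum]
  refine Finset.sum_le_sum fun i _ => Finset.sum_le_sum fun j _ => ?_
  have hscalar := mul_le_mul_of_nonneg_left (exp_sub_exp_add_sq_le (hA0 i) (hB0 j))
    (spectralOverlap_nonneg hA hB i j)
  simp only [Pi.one_apply, id]
  linarith

end SpectralOverlap

namespace Herm

variable {m : ℕ}

theorem coe_exp_eq_cfc (Y : Herm m) :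
    (Y.exp : Matrix (Fin m) (Fin m) ℂ) = cfc Real.exp (Y : Matrix (Fin m) (Fin m) ℂ) :=
  (CFC.real_exp_eq_normedSpace_exp Y.2).symm

theorem exp_injective (m : ℕ) : Function.Injective (exp (m := m)) := by
  intro Y Y' h
  have hlog := congrArg CFC.log (congrArg Subtype.val h)
  exact Subtype.ext (by rwa [exp, exp, CFC.log_exp _ Y.2, CFC.log_exp _ Y'.2] at hlog)

open scoped MatrixOrder in
theorem exp_posSemidef (Y : Herm m) : (Y.exp : Matrix (Fin m) (Fin m) ℂ).PosSemidef := by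
  rw [coe_exp_eq_cfc, ← Matrix.nonneg_iff_posSemidef]
  exact cfc_nonneg fun _ _ => (Real.exp_pos _).le

theorem exp_sub_smul_one (Y : Herm m) (c : ℝ) :
    (Y - c • (1 : Herm m)).exp = Real.exp (-c) • Y.exp := by
  refine Subtype.ext ?_
  have hscalar : NormedSpace.exp ((-c) • (1 : Matrix (Fin m) (Fin m) ℂ)) =
      Real.exp (-c) • (1 : Matrix (Fin m) (Fin m) ℂ) := by
    rw [← Algebra.algebraMap_eq_smul_one, ← Algebra.algebraMap_eq_smul_one, Real.exp_eq_exp_ℝ,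
      NormedSpace.algebraMap_exp_comm]
  have hcoe : ((Y - c • (1 : Herm m) : Herm m) : Matrix (Fin m) (Fin m) ℂ) =
      (-c) • (1 : Matrix (Fin m) (Fin m) ℂ) + (Y : Matrix (Fin m) (Fin m) ℂ) := by
    simp only [AddSubgroupClass.coe_sub, selfAdjoint.val_smul, selfAdjoint.val_one, neg_smul]
    abel
  change NormedSpace.exp _ = Real.exp (-c) • NormedSpace.exp _
  rw [hcoe, Matrix.exp_add_of_commute _ _ ((Commute.one_left _).smul_left _), hscalar,
    smul_mul_assoc, one_mul]

theorem nuclearNorm_of_posSemidef {X : Herm m} (hX : (X : Matrix (Fin m) (Fin m) ℂ).PosSemidef) :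
    X.nuclearNorm = (X : Matrix (Fin m) (Fin m) ℂ).trace.re := by
  rw [X.isHermitian.trace_eq_sum_eigenvalues, nuclearNorm, Complex.re_sum]
  exact Finset.sum_congr rfl fun i _ => abs_of_nonneg (hX.eigenvalues_nonneg i)

theorem trace_exp (Y : Herm m) :
    (Y.exp : Matrix (Fin m) (Fin m) ℂ).trace.re = Y.exp.nuclearNorm :=
  (nuclearNorm_of_posSemidef Y.exp_posSemidef).symm

theorem nuclearNorm_exp_nonneg (Y : Herm m) : 0 ≤ Y.exp.nuclearNorm :=
  Finset.sum_nonneg fun _ _ => abs_nonneg _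

theorem eigenvalues_nonpos_of_nuclearNorm_exp_le_one {Y : Herm m} (h : Y.exp.nuclearNorm ≤ 1)
    (i : Fin m) : Y.isHermitian.eigenvalues i ≤ 0 := by
  have htrace := re_trace_cfc Y.isHermitian Real.exp
  rw [← coe_exp_eq_cfc] at htrace
  rw [← trace_exp] at h
  rw [← Real.exp_le_one_iff]
  refine (Finset.single_le_sum (f := fun i => Real.exp (Y.isHermitian.eigenvalues i))
    (fun _ _ => (Real.exp_pos _).le) (Finset.mem_univ i)).trans ?_
  exact htrace ▸ h

/-- The free energy `log (1 + tr exp Y)`, the convex potential of the normalized exponential. -/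
noncomputable def freeEnergy (Y : Herm m) : ℝ := Real.log (1 + Y.exp.nuclearNorm)

/-- The normalized exponential `exp Y / (1 + tr exp Y)`, the choice map of a player with `A = 1`. -/
noncomputable def softmax (Y : Herm m) : Herm m := (1 / (1 + Y.exp.nuclearNorm)) • Y.exp

/-- The matrix logarithm `Y - log (1 + tr exp Y) I` of the normalized exponential of `Y`. -/
noncomputable def logSoftmax (Y : Herm m) : Herm m := Y - Y.freeEnergy • (1 : Herm m)

theorem exp_freeEnergy (Y : Herm m) : Real.exp Y.freeEnergy = 1 + Y.exp.nuclearNorm :=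
  Real.exp_log (by have := Y.nuclearNorm_exp_nonneg; positivity)

theorem freeEnergy_nonneg (Y : Herm m) : 0 ≤ Y.freeEnergy :=
  Real.log_nonneg (by have := Y.nuclearNorm_exp_nonneg; linarith)

theorem exp_logSoftmax (Y : Herm m) : Y.logSoftmax.exp = Y.softmax := by
  rw [logSoftmax, exp_sub_smul_one, softmax, Real.exp_neg, exp_freeEnergy, one_div]

theorem trace_softmax (Y : Herm m) :
    (Y.softmax : Matrix (Fin m) (Fin m) ℂ).trace.re = 1 - Real.exp (-Y.freeEnergy) := by
  have := Y.nuclearNorm_exp_nonneg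
  rw [softmax, selfAdjoint.val_smul, Matrix.trace_smul, Complex.smul_re, trace_exp, smul_eq_mul,
    Real.exp_neg, exp_freeEnergy]
  field_simp
  ring

theorem softmax_injective (m : ℕ) : Function.Injective (softmax (m := m)) := by
  intro Y Y' h
  have hfree : Y.freeEnergy = Y'.freeEnergy := by
    have htrace := congrArg (fun X : Herm m => (X : Matrix (Fin m) (Fin m) ℂ).trace.re) h
    rw [trace_softmax, trace_softmax, sub_right_inj, Real.exp_eq_exp, neg_inj] at htrace
    exact htrace
  rw [← exp_logSoftmax, ← exp_logSoftmax] at h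
  have hlog := exp_injective m h
  rwa [logSoftmax, logSoftmax, hfree, sub_left_inj] at hlog

theorem eigenvalues_logSoftmax_nonpos (Y : Herm m) (i : Fin m) :
    Y.logSoftmax.isHermitian.eigenvalues i ≤ 0 := by
  refine eigenvalues_nonpos_of_nuclearNorm_exp_le_one ?_ i
  rw [← trace_exp, exp_logSoftmax, trace_softmax]
  linarith [Real.exp_pos (-Y.freeEnergy)]

theorem tracePairing_apply (A B : Herm m) : tracePairing m A B =
    ((A : Matrix (Fin m) (Fin m) ℂ) * (B : Matrix (Fin m) (Fin m) ℂ)).trace.re := rfl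

theorem tracePairing_comm (A B : Herm m) : tracePairing m A B = tracePairing m B A := by
  rw [tracePairing_apply, tracePairing_apply, Matrix.trace_mul_comm]

theorem tracePairing_one_right (A : Herm m) :
    tracePairing m A 1 = (A : Matrix (Fin m) (Fin m) ℂ).trace.re := by
  rw [tracePairing_apply, selfAdjoint.val_one, mul_one]

theorem tracePairing_self_nonneg (A : Herm m) : 0 ≤ tracePairing m A A := by
  have hsq := (Matrix.posSemidef_conjTranspose_mul_self (A : Matrix (Fin m) (Fin m) ℂ)).trace_nonneg
  rw [A.isHermitian.eq] at hsq
  exact (Complex.le_def.1 hsq).1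

theorem tracePairing_self_pos {A : Herm m} (hA : A ≠ 0) : 0 < tracePairing m A A := by
  refine (tracePairing_self_nonneg A).lt_of_ne' fun h => hA (Subtype.ext ?_)
  have hsq := (Matrix.posSemidef_conjTranspose_mul_self (A : Matrix (Fin m) (Fin m) ℂ)).trace_nonneg
  rw [ZeroMemClass.coe_zero, ← Matrix.trace_conjTranspose_mul_self_eq_zero_iff]
  have him := (Complex.le_def.1 hsq).2
  rw [A.isHermitian.eq] at him ⊢
  exact Complex.ext h him.symm

theorem freeEnergy_cocoercive (Y Y' : Herm m) :
    Y.freeEnergy + tracePairing m Y.softmax (Y' - Y) +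
      1 / 4 * tracePairing m (Y'.softmax - Y.softmax) (Y'.softmax - Y.softmax) ≤ Y'.freeEnergy := by
  have hklein := klein_trace_inequality Y.logSoftmax.isHermitian Y'.logSoftmax.isHermitian
    Y.eigenvalues_logSoftmax_nonpos Y'.eigenvalues_logSoftmax_nonpos
  simp only [← coe_exp_eq_cfc, exp_logSoftmax, RCLike.re_eq_complex_re, trace_softmax,
    ← AddSubgroupClass.coe_sub, ← tracePairing_apply] at hklein
  have hlin : tracePairing m Y.softmax (Y.logSoftmax - Y'.logSoftmax) =
      -tracePairing m Y.softmax (Y' - Y) +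
        (Y'.freeEnergy - Y.freeEnergy) * (1 - Real.exp (-Y.freeEnergy)) := by
    simp only [logSoftmax, map_sub, map_smul, tracePairing_one_right, trace_softmax, smul_eq_mul]
    ring
  have hflip : tracePairing m (Y'.softmax - Y.softmax) (Y'.softmax - Y.softmax) =
      tracePairing m (Y.softmax - Y'.softmax) (Y.softmax - Y'.softmax) := by
    rw [← neg_sub, map_neg, map_neg, LinearMap.neg_apply, neg_neg]
  have hslack := exp_sub_exp_add_sq_le (neg_nonpos.2 Y.freeEnergy_nonneg)
    (neg_nonpos.2 Y'.freeEnergy_nonneg)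
  rw [hflip]
  linarith [sq_nonneg (Real.exp (-Y.freeEnergy) - Real.exp (-Y'.freeEnergy))]

theorem tracePairing_le_freeEnergy {A : ℝ} {P : Herm m} (hP : P ∈ actionSet m A) (Y : Herm m) :
    tracePairing m P Y ≤ A * Y.freeEnergy := by
  have hlog := re_trace_mul_nonpos hP.1 Y.logSoftmax.isHermitian Y.eigenvalues_logSoftmax_nonpos
  have hY : Y = Y.logSoftmax + Y.freeEnergy • (1 : Herm m) := (sub_add_cancel _ _).symm
  calc tracePairing m P Y
      = tracePairing m P Y.logSoftmax + Y.freeEnergy * P.nuclearNorm := by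
        conv_lhs => rw [hY]
        rw [map_add, map_smul, tracePairing_one_right, nuclearNorm_of_posSemidef hP.1, smul_eq_mul]
    _ ≤ 0 + Y.freeEnergy * A :=
        add_le_add hlog (mul_le_mul_of_nonneg_left hP.2 Y.freeEnergy_nonneg)
    _ = A * Y.freeEnergy := by ring

end Herm

/-! ### Semidefinite games -/

section PositiveForms

variable {E F : Type*} [NormedAddCommGroup E] [NormedSpace ℝ E] [FiniteDimensional ℝ E]
  [NormedAddCommGroup F] [NormedSpace ℝ F]

theorem isCoercive_of_forall_pos {B : E →L[ℝ] E →L[ℝ] ℝ} (hB : ∀ u ≠ 0, 0 < B u u) :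
    IsCoercive B := by
  have := FiniteDimensional.proper ℝ E
  rcases subsingleton_or_nontrivial E with hE | hE
  · exact ⟨1, one_pos, fun u => by simp [Subsingleton.elim u 0]⟩
  have hcont : Continuous fun u => B u u := by fun_prop
  obtain ⟨v, hv, hmin⟩ := (isCompact_sphere (0 : E) 1).exists_isMinOn
    (NormedSpace.sphere_nonempty.2 zero_le_one) hcont.continuousOn
  refine ⟨B v v, hB v (ne_zero_of_mem_unit_sphere ⟨v, hv⟩), fun u => ?_⟩
  rcases eq_or_ne u 0 with rfl | hu
  · simp
  have hscale : B v v ≤ ‖u‖⁻¹ * (‖u‖⁻¹ * B u u) := by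
    have := hmin (show ‖u‖⁻¹ • u ∈ Metric.sphere (0 : E) 1 by simp [norm_smul, hu])
    simpa using this
  calc B v v * ‖u‖ * ‖u‖ ≤ ‖u‖⁻¹ * (‖u‖⁻¹ * B u u) * ‖u‖ * ‖u‖ := by gcongr
    _ = B u u := by field_simp [norm_ne_zero_iff.2 hu]

theorem exists_eventually_pairing_sub_le {p : E →L[ℝ] F →L[ℝ] ℝ} {V : E → F} {V' : E →L[ℝ] F}
    {s : Set E} {x : E} (hV : HasFDerivWithinAt V V' s x) (hneg : ∀ u ≠ 0, p u (V' u) < 0) :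
    ∃ c > 0, ∀ᶠ y in 𝓝[s] x, p (y - x) (V y - V x) ≤ -c * ‖y - x‖ ^ 2 := by
  obtain ⟨c, hc, hcoer⟩ := isCoercive_of_forall_pos
    (B := -p.bilinearComp (ContinuousLinearMap.id ℝ E) V') fun u hu => by
      simpa using hneg u hu
  refine ⟨c / 2, half_pos hc, ?_⟩
  filter_upwards [hV.isLittleO.def (show 0 < c / (2 * (‖p‖ + 1)) by positivity)] with y hy
  have hlinear : c * ‖y - x‖ * ‖y - x‖ ≤ -p (y - x) (V' (y - x)) := hcoer (y - x)
  have hrest : p (y - x) (V y - V x - V' (y - x)) ≤ c / 2 * ‖y - x‖ ^ 2 :=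
    calc p (y - x) (V y - V x - V' (y - x))
        ≤ ‖p‖ * ‖y - x‖ * ‖V y - V x - V' (y - x)‖ :=
          (Real.le_norm_self _).trans (p.le_opNorm₂ _ _)
      _ ≤ (‖p‖ + 1) * ‖y - x‖ * (c / (2 * (‖p‖ + 1)) * ‖y - x‖) := by gcongr; linarith
      _ = c / 2 * ‖y - x‖ ^ 2 := by field_simp
  rw [map_sub] at hrest
  linarith

end PositiveForms

/-- The trace pairing of block-diagonal Hermitian matrices. -/
noncomputable def profilePairing {N : ℕ} (M : Fin N → ℕ) :
    Profile M →L[ℝ] Profile M →L[ℝ] ℝ :=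
  (∑ i, (Herm.tracePairing (M i)).compl₁₂ (LinearMap.proj i : Profile M →ₗ[ℝ] Herm (M i))
    (LinearMap.proj i : Profile M →ₗ[ℝ] Herm (M i))).toContinuousBilinearMap

theorem profilePairing_apply {N : ℕ} {M : Fin N → ℕ} (X Y : Profile M) :
    profilePairing M X Y = ∑ i, Herm.tracePairing (M i) (X i) (Y i) := by
  rw [profilePairing, LinearMap.toContinuousBilinearMap_apply]
  simp only [LinearMap.sum_apply, LinearMap.compl₁₂_apply, LinearMap.proj_apply]

theorem profilePairing_self_pos {N : ℕ} {M : Fin N → ℕ} {X : Profile M} (hX : X ≠ 0) :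
    0 < profilePairing M X X := by
  obtain ⟨i, hi⟩ := Function.ne_iff.1 hX
  rw [profilePairing_apply]
  exact Finset.sum_pos' (fun j _ => Herm.tracePairing_self_nonneg (X j))
    ⟨i, Finset.mem_univ i, Herm.tracePairing_self_pos hi⟩

theorem mem_actionSet_iff {m : ℕ} {A : ℝ} {X : Herm m} : X ∈ actionSet m A ↔
    (X : Matrix (Fin m) (Fin m) ℂ).PosSemidef ∧ (X : Matrix (Fin m) (Fin m) ℂ).trace.re ≤ A :=
  and_congr_right fun h => by rw [Herm.nuclearNorm_of_posSemidef h]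

theorem convex_actionSet (m : ℕ) (A : ℝ) : Convex ℝ (actionSet m A) := by
  intro X hX Y hY a b ha hb hab
  rw [mem_actionSet_iff] at hX hY ⊢
  simp only [AddSubgroup.coe_add, selfAdjoint.val_smul, Matrix.trace_add, Matrix.trace_smul,
    Complex.add_re, Complex.smul_re, smul_eq_mul]
  refine ⟨(hX.1.smul ha).add (hY.1.smul hb), ?_⟩
  calc _ ≤ a * A + b * A := by gcongr; exacts [hX.2, hY.2]
    _ = A := by rw [← add_mul, hab, one_mul]

open scoped MatrixOrder in
theorem mem_actionSet_of_norm_sub_le {m : ℕ} {A c : ℝ} (hA : 2 * c * m ≤ A) {X : Herm m}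
    (hX : ‖X - c • (1 : Herm m)‖ ≤ c) : X ∈ actionSet m A := by
  have hsa : IsSelfAdjoint ((X - c • (1 : Herm m) : Herm m) : Matrix (Fin m) (Fin m) ℂ) :=
    (X - c • (1 : Herm m)).2
  have hbound := algebraMap_mono (Matrix (Fin m) (Fin m) ℂ)
    (show ‖((X - c • (1 : Herm m) : Herm m) : Matrix (Fin m) (Fin m) ℂ)‖ ≤ c from hX)
  have hlower := (neg_le_neg hbound).trans hsa.neg_algebraMap_norm_le_self
  have hupper := hsa.le_algebraMap_norm_self.trans hbound
  simp only [Algebra.algebraMap_eq_smul_one, AddSubgroupClass.coe_sub, selfAdjoint.val_smul,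
    selfAdjoint.val_one] at hlower hupper
  have htrace := (Complex.le_def.1 (Matrix.le_iff.1 hupper).trace_nonneg).1
  simp only [Matrix.trace_sub, Matrix.trace_smul, Matrix.trace_one, Complex.sub_re, Complex.smul_re,
    Fintype.card_fin, Complex.natCast_re, Complex.zero_re, smul_eq_mul] at htrace
  refine mem_actionSet_iff.2 ⟨Matrix.nonneg_iff_posSemidef.1 ?_, by linarith⟩
  simpa using add_le_add_left hlower (c • (1 : Matrix (Fin m) (Fin m) ℂ))

theorem isCoercive_profilePairing {N : ℕ} (M : Fin N → ℕ) : IsCoercive (profilePairing M) :=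
  isCoercive_of_forall_pos (E := Profile M) fun _ => profilePairing_self_pos

namespace SemidefiniteGame

variable {N : ℕ} (G : SemidefiniteGame N)

theorem convex_feasible : Convex ℝ G.feasible := fun _ hX _ hY _ _ ha hb hab i =>
  convex_actionSet _ _ (hX i) (hY i) ha hb hab

theorem interior_feasible_nonempty : (interior G.feasible).Nonempty := by
  let c : Fin N → ℝ := fun i => G.A i / (2 * (G.M i + 1))
  have hc : ∀ i, 0 < c i := fun i => by have := G.A_pos i; positivity
  have hsize : ∀ i, 2 * c i * G.M i ≤ G.A i := fun i => by
    have := G.A_pos i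
    rw [mul_div_assoc', div_mul_eq_mul_div, div_le_iff₀ (by positivity)]
    nlinarith
  have hnear : ∀ᶠ X : Profile G.M in 𝓝 fun i => c i • (1 : Herm (G.M i)),
      ∀ i, ‖X i - c i • (1 : Herm (G.M i))‖ ≤ c i := by
    refine eventually_all.2 fun i => ?_
    have hcont : Continuous fun X : Profile G.M => ‖X i - c i • (1 : Herm (G.M i))‖ := by fun_prop
    exact (hcont.tendsto _).eventually_le_const (by simpa using hc i)
  exact ⟨_, mem_interior_iff_mem_nhds.2 <| mem_of_superset hnear fun X hX i =>
    mem_actionSet_of_norm_sub_le (hsize i) (hX i)⟩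

theorem uniqueDiffOn_feasible : UniqueDiffOn ℝ G.feasible :=
  uniqueDiffOn_convex G.convex_feasible G.interior_feasible_nonempty

theorem choice_eq (Y : Profile G.M) (i : Fin N) : G.choice Y i = G.A i • (Y i).softmax := by
  rw [choice, Herm.softmax, smul_smul, mul_one_div]

theorem choice_mem (Y : Profile G.M) : G.choice Y ∈ G.feasible := fun i => by
  have hA := G.A_pos i
  have := (Y i).nuclearNorm_exp_nonneg
  refine mem_actionSet_iff.2 ⟨(Y i).exp_posSemidef.smul (by positivity), ?_⟩
  rw [choice_eq, selfAdjoint.val_smul, Matrix.trace_smul, Complex.smul_re, Herm.trace_softmax]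
  exact mul_le_of_le_one_right hA.le (sub_le_self _ (Real.exp_pos _).le)

theorem choice_injective : Function.Injective G.choice := by
  intro Y Y' h
  ext1 i
  have hsoftmax : (Y i).softmax = (Y' i).softmax := by
    have := congrFun h i
    rw [choice_eq, choice_eq] at this
    exact smul_right_injective _ (G.A_pos i).ne' this
  exact Herm.softmax_injective _ hsoftmax

/-- The potential `∑ i, A i * log (1 + tr exp (Y i))`, whose gradient is the choice map. -/
noncomputable def potential (Y : Profile G.M) : ℝ := ∑ i, G.A i * (Y i).freeEnergy

theorem pairing_le_potential {X : Profile G.M} (hX : X ∈ G.feasible) (Y : Profile G.M) :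
    profilePairing G.M X Y ≤ G.potential Y := by
  rw [profilePairing_apply, potential]
  exact Finset.sum_le_sum fun i _ => Herm.tracePairing_le_freeEnergy (hX i) (Y i)

theorem potential_cocoercive (Y Y' : Profile G.M) : G.potential Y +
    profilePairing G.M (G.choice Y) (Y' - Y) + 1 / (4 * (1 + ∑ i, G.A i)) *
      profilePairing G.M (G.choice Y' - G.choice Y) (G.choice Y' - G.choice Y) ≤
        G.potential Y' := by
  simp only [potential, profilePairing_apply, Finset.mul_sum, ← Finset.sum_add_distrib]
  refine Finset.sum_le_sum fun i _ => ?_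
  have hA := G.A_pos i
  have hAle : G.A i ≤ 1 + ∑ j, G.A j :=
    (Finset.single_le_sum (fun j _ => (G.A_pos j).le) (Finset.mem_univ i)).trans
      (le_add_of_nonneg_left zero_le_one)
  have hblock := mul_le_mul_of_nonneg_left ((Y i).freeEnergy_cocoercive (Y' i)) hA.le
  have hweight : 1 / (4 * (1 + ∑ j, G.A j)) * (G.A i * (G.A i)) ≤ G.A i * (1 / 4) := by
    rw [one_div_mul_eq_div, div_le_iff₀ (by linarith)]
    nlinarith
  have hsq := mul_le_mul_of_nonneg_right hweight
    (Herm.tracePairing_self_nonneg ((Y' i).softmax - (Y i).softmax))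
  simp only [Pi.sub_apply, choice_eq, ← smul_sub, map_smul, LinearMap.smul_apply, smul_eq_mul]
  linarith

theorem exists_isCocoerciveGradient :
    ∃ κ, IsCocoerciveGradient (profilePairing G.M) G.potential G.choice κ := by
  obtain ⟨c, hc, hcoer⟩ := isCoercive_profilePairing G.M
  have hA : 0 ≤ ∑ i, G.A i := Finset.sum_nonneg fun i _ => (G.A_pos i).le
  set a := 1 / (4 * (1 + ∑ i, G.A i))
  have ha_pos : 0 < a := by positivity
  refine ⟨a * c, mul_pos ha_pos hc, fun Y Y' => le_trans ?_ (G.potential_cocoercive Y Y')⟩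
  have hsq := mul_le_mul_of_nonneg_left (hcoer (G.choice Y' - G.choice Y)) ha_pos.le
  linarith

theorem continuous_choice : Continuous G.choice :=
  G.exists_isCocoerciveGradient.choose_spec.continuous

/-- The Hermitian matrix representing, through the trace, the restriction of a functional to the
`i`-th block; applied to `fderivWithin ℝ (G.u i) G.feasible X` it gives `V_i(X)`. -/
noncomputable def blockGradient (i : Fin N) : (Profile G.M →L[ℝ] ℝ) →L[ℝ] Herm (G.M i) :=
  LinearMap.toContinuousLinearMap
    { toFun := fun φ => Herm.ofDual ((φ : Profile G.M →ₗ[ℝ] ℝ) ∘ₗ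
        LinearMap.single ℝ (fun j => Herm (G.M j)) i)
      map_add' := fun φ ψ => by
        rw [Herm.ofDual, Herm.ofDual, Herm.ofDual, ← map_add]; rfl
      map_smul' := fun t φ => by
        rw [Herm.ofDual, Herm.ofDual, RingHom.id_apply, ← map_smul]; rfl }

theorem V_apply (X : Profile G.M) (i : Fin N) :
    G.V X i = G.blockGradient i (fderivWithin ℝ (G.u i) G.feasible X) := rfl

theorem tracePairing_blockGradient (i : Fin N) (H : Herm (G.M i)) (φ : Profile G.M →L[ℝ] ℝ) :
    Herm.tracePairing (G.M i) H (G.blockGradient i φ) = φ (Pi.single i H) := by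
  rw [Herm.tracePairing_comm]
  exact Herm.trace_ofDual_mul _ H

/-- The derivative at `X` of the payoff gradient `V`, taken within the feasible set. -/
noncomputable def payoffJacobian (X : Profile G.M) : Profile G.M →L[ℝ] Profile G.M :=
  ContinuousLinearMap.pi fun i => (G.blockGradient i).comp
    (fderivWithin ℝ (fderivWithin ℝ (G.u i) G.feasible) G.feasible X)

theorem hasFDerivWithinAt_V {X : Profile G.M} (hX : X ∈ G.feasible) :
    HasFDerivWithinAt G.V (G.payoffJacobian X) G.feasible X := by
  refine (hasFDerivWithinAt_pi (𝕜 := ℝ) (E := Profile G.M)).2 fun i => ?_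
  have hC1 := (G.smooth i).fderivWithin G.uniqueDiffOn_feasible (m := 1) (by norm_num)
  exact (G.blockGradient i).hasFDerivAt.comp_hasFDerivWithinAt (E := Profile G.M) X
    (hC1.differentiableOn one_ne_zero X hX).hasFDerivWithinAt

theorem continuousOn_V : ContinuousOn G.V G.feasible := fun _ hX =>
  (G.hasFDerivWithinAt_V hX).continuousWithinAt

theorem pairing_payoffJacobian (X H : Profile G.M) :
    profilePairing G.M H (G.payoffJacobian X H) =
      ∑ i, ∑ j, G.hessianBlock i j X (H i) (H j) := by
  have hmixed : profilePairing G.M H (G.payoffJacobian X H) =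
      ∑ i, ∑ j, G.mixedDeriv i j i X (H j) (H i) := by
    rw [profilePairing_apply]
    refine Finset.sum_congr rfl fun i _ => ?_
    change Herm.tracePairing (G.M i) (H i) (G.blockGradient i _) = _
    rw [tracePairing_blockGradient]
    conv_lhs => rw [← Finset.univ_sum_single H, map_sum, sum_apply]
    simp only [Finset.univ_sum_single]
    rfl
  have hswap : ∑ i, ∑ j, G.mixedDeriv j i j X (H i) (H j) =
      ∑ i, ∑ j, G.mixedDeriv i j i X (H j) (H i) := Finset.sum_comm
  simp only [hessianBlock, Finset.sum_add_distrib, ← Finset.mul_sum]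
  rw [hmixed, hswap]
  ring

variable {G}

theorem update_mem_feasible {X : Profile G.M} (hX : X ∈ G.feasible) {i : Fin N} {Xi : Herm (G.M i)}
    (hXi : Xi ∈ actionSet (G.M i) (G.A i)) : Function.update X i Xi ∈ G.feasible := fun j => by
  rcases eq_or_ne j i with rfl | hj
  · simpa using hXi
  · simpa [Function.update_of_ne hj] using hX j

theorem IsNash.fderivWithin_nonpos {Xs : Profile G.M} (h : G.IsNash Xs) {i : Fin N}
    {Xi : Herm (G.M i)} (hXi : Xi ∈ actionSet (G.M i) (G.A i)) :
    fderivWithin ℝ (G.u i) G.feasible Xs (Pi.single i (Xi - Xs i)) ≤ 0 := by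
  have hsub : Function.update Xs i '' actionSet (G.M i) (G.A i) ⊆ G.feasible :=
    Set.image_subset_iff.2 fun _ => update_mem_feasible h.1
  have hmax : IsLocalMaxOn (G.u i) (Function.update Xs i '' actionSet (G.M i) (G.A i)) Xs :=
    eventually_of_mem self_mem_nhdsWithin (Set.forall_mem_image.2 fun _ => h.2 i _)
  have hsegment : segment ℝ Xs (Function.update Xs i Xi) ⊆
      Function.update Xs i '' actionSet (G.M i) (G.A i) := by
    have himage := Set.image_mono (f := Function.update Xs i)
      ((convex_actionSet _ _).segment_subset (h.1 i) hXi)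
    rwa [Pi.image_update_segment, Function.update_eq_self] at himage
  have hdirection : Pi.single i (Xi - Xs i) = Function.update Xs i Xi - Xs := by
    ext1 j
    rcases eq_or_ne j i with rfl | hj
    · simp
    · simp [hj]
  rw [hdirection]
  exact hmax.hasFDerivWithinAt_nonpos
    (((G.smooth i).differentiableOn two_ne_zero Xs h.1).hasFDerivWithinAt.mono hsub)
    (sub_mem_posTangentConeAt_of_segment_subset hsegment)

theorem IsNash.pairing_nonpos {Xs : Profile G.M} (h : G.IsNash Xs) {X : Profile G.M}
    (hX : X ∈ G.feasible) : profilePairing G.M (X - Xs) (G.V Xs) ≤ 0 := by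
  rw [profilePairing_apply]
  refine Finset.sum_nonpos fun i _ => ?_
  rw [V_apply, tracePairing_blockGradient]
  exact h.fderivWithin_nonpos (hX i)

theorem exists_isDualAveraging {Xs : Profile G.M} (hNash : G.IsNash Xs)
    (hD : G.HessianNegDef Xs) : ∃ κ c C R,
      IsDualAveraging (profilePairing G.M) G.potential G.choice G.V Xs κ c C R := by
  have hderiv := G.hasFDerivWithinAt_V hNash.1
  obtain ⟨κ, hκ⟩ := G.exists_isCocoerciveGradient
  obtain ⟨c, hc, hmono⟩ := exists_eventually_pairing_sub_le (E := Profile G.M)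
    (F := Profile G.M) (p := profilePairing G.M) hderiv
    fun H hH => (G.pairing_payoffJacobian Xs H).trans_lt (hD H hH)
  obtain ⟨C, hC, hlip⟩ := (HasFDerivWithinAt.isBigO_sub (𝕜 := ℝ) (E := Profile G.M)
    (F := Profile G.M) hderiv).exists_pos
  obtain ⟨R, hR, hball⟩ := Metric.mem_nhdsWithin_iff.1 (hmono.and hlip.bound)
  have hnear : ∀ Y, ‖G.choice Y - Xs‖ ≤ R / 2 → G.choice Y ∈ Metric.ball Xs R ∩ G.feasible :=
    fun Y hY => ⟨mem_ball_iff_norm.2 (by linarith), G.choice_mem Y⟩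
  exact ⟨κ, min c 1, C, R / 2,
    { hκ with
      c_pos := lt_min hc one_pos
      c_le_one := min_le_right _ _
      C_nonneg := hC.le
      R_pos := half_pos hR
      lower := G.pairing_le_potential hNash.1
      vi := fun Y => hNash.pairing_nonpos (G.choice_mem Y)
      monotone := fun Y hY => (hball (hnear Y hY)).1.trans <| by gcongr; exact min_le_left _ _
      lipschitz_at := fun Y hY => (hball (hnear Y hY)).2 }⟩

end SemidefiniteGame

theorem stronglyMeasurable_of_comap_comp_le {E F Ω : Type*} [NormedAddCommGroup E]
    [NormedAddCommGroup F] [NormedSpace ℝ F] [FiniteDimensional ℝ F] {Q : F → E}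
    (hQ : Continuous Q) (hinj : Function.Injective Q) {m : MeasurableSpace Ω} {Y : Ω → F}
    (hY : MeasurableSpace.comap (fun ω => Q (Y ω)) (borel E) ≤ m) : StronglyMeasurable[m] Y := by
  borelize E F
  have := FiniteDimensional.proper ℝ F
  have hcomp : Measurable[m] (Q ∘ Y) := measurable_iff_comap_le.2 hY
  exact ((hQ.measurableEmbedding hinj).measurable_comp_iff.1 hcomp).stronglyMeasurable

theorem summable_sq_of_summable_rpow {γ : ℕ → ℝ} (hγ : ∀ n, 0 < γ n) {p : ℝ} (hp0 : 0 ≤ p)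
    (hp2 : p ≤ 2) (hs : Summable fun n => γ n ^ p) : Summable fun n => γ n ^ 2 := by
  refine Summable.of_norm_bounded_eventually_nat hs ?_
  filter_upwards [hs.tendsto_atTop_zero.eventually_lt_const one_pos] with n hn
  have hle : γ n ≤ 1 := by
    by_contra! h
    exact hn.not_ge (Real.one_le_rpow h.le hp0)
  rw [Real.norm_of_nonneg (sq_nonneg _), ← Real.rpow_two]
  exact Real.rpow_le_rpow_of_exponent_ge (hγ n) hle hp2

namespace SemidefiniteGame

variable {N : ℕ} (G : SemidefiniteGame N) {Ω : Type*} {m0 : MeasurableSpace Ω}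

/-- A run of matrix exponential learning in which the noise has zero mean and second moment at most
`σ ^ 2` conditionally on the history, with no assumption on its higher moments. -/
structure IsSecondMomentRun (P : Measure Ω) (γ : ℕ → ℝ) (σ : ℝ)
    (Y Z : ℕ → Ω → Profile G.M) : Prop where
  measurable_init : StronglyMeasurable (Y 0)
  measurable_noise : ∀ n, StronglyMeasurable (Z n)
  update : ∀ n ω, Y (n + 1) ω = Y n ω + γ n • (G.V (G.choice (Y n ω)) + Z n ω)
  integrable_sq : ∀ n, Integrable (fun ω => ‖Z n ω‖ ^ 2) P
  zero_mean : ∀ n, P[Z n | G.history Y n] =ᵐ[P] 0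
  second_moment : ∀ n, P[fun ω => ‖Z n ω‖ ^ 2 | G.history Y n] ≤ᵐ[P] fun _ => σ ^ 2

theorem history_mono (Y : ℕ → Ω → Profile G.M) : Monotone (G.history Y) := fun _ _ hnk =>
  iSup₂_le fun k hk => le_iSup₂_of_le k (hk.trans hnk) le_rfl

theorem comap_choice_le_history (Y : ℕ → Ω → Profile G.M) (n : ℕ) :
    MeasurableSpace.comap (fun ω => G.choice (Y n ω)) (borel (Profile G.M)) ≤ G.history Y n :=
  le_iSup₂_of_le n le_rfl le_rfl

theorem measurableSet_history (Y : ℕ → Ω → Profile G.M) (n : ℕ) {U : Set (Profile G.M)}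
    (hU : IsOpen U) : MeasurableSet[G.history Y n] {ω | G.choice (Y n ω) ∈ U} :=
  G.comap_choice_le_history Y n _ ⟨U, MeasurableSpace.measurableSet_generateFrom hU, rfl⟩

theorem stronglyMeasurable_history (Y : ℕ → Ω → Profile G.M) (n : ℕ) :
    StronglyMeasurable[G.history Y n] (Y n) :=
  stronglyMeasurable_of_comap_comp_le G.continuous_choice G.choice_injective
    (G.comap_choice_le_history Y n)

theorem continuous_V_choice : Continuous fun Y => G.V (G.choice Y) :=
  G.continuousOn_V.comp_continuous G.continuous_choice G.choice_mem

variable {G} {P : Measure Ω} {γ : ℕ → ℝ} {σ : ℝ} {Y Z : ℕ → Ω → Profile G.M}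

theorem IsMXLRun.isSecondMomentRun (h : G.IsMXLRun P γ σ Y Z) : G.IsSecondMomentRun P γ σ Y Z where
  measurable_init := h.measurable_init
  measurable_noise := h.measurable_noise
  update := h.update
  integrable_sq n := h.integrable_noise n 2 one_le_two
  zero_mean := h.zero_mean
  second_moment n := by simpa using h.subexponential n 2 one_le_two

namespace IsSecondMomentRun

theorem stronglyMeasurable (h : G.IsSecondMomentRun P γ σ Y Z) (n : ℕ) :
    StronglyMeasurable (Y n) := by
  induction n with
  | zero => exact h.measurable_init
  | succ n ih =>
    rw [funext (h.update n)]
    exact ih.add (((G.continuous_V_choice.comp_stronglyMeasurable ih).add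
      (h.measurable_noise n)).const_smul (γ n))

/-- The filtration generated by the actions of a run. -/
noncomputable def filtration (h : G.IsSecondMomentRun P γ σ Y Z) : Filtration ℕ m0 where
  seq := G.history Y
  mono' := G.history_mono Y
  le' n := iSup₂_le fun k _ => by
    borelize (Profile G.M)
    exact (G.continuous_choice.comp_stronglyMeasurable (h.stronglyMeasurable k)).measurable.comap_le

theorem stronglyMeasurable_noise_history (h : G.IsSecondMomentRun P γ σ Y Z)
    (hγ : ∀ n, 0 < γ n) (n : ℕ) : StronglyMeasurable[G.history Y (n + 1)] (Z n) := by
  have hZ : Z n = fun ω => (γ n)⁻¹ • (Y (n + 1) ω - Y n ω) - G.V (G.choice (Y n ω)) := by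
    ext1 ω
    rw [h.update n ω, add_sub_cancel_left, inv_smul_smul₀ (hγ n).ne', add_sub_cancel_left]
  have hY := (G.stronglyMeasurable_history Y n).mono (G.history_mono Y n.le_succ)
  rw [hZ]
  exact (((G.stronglyMeasurable_history Y (n + 1)).sub hY).const_smul (γ n)⁻¹).sub
    (G.continuous_V_choice.comp_stronglyMeasurable hY)

theorem isStochasticRun (h : G.IsSecondMomentRun P γ σ Y Z) (hγ : ∀ n, 0 < γ n) :
    IsStochasticRun G.choice G.V h.filtration P γ σ Y Z where
  noise :=
    { stronglyMeasurable := h.stronglyMeasurable_noise_history hγ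
      memLp := fun n => (memLp_two_iff_integrable_sq_norm
        (h.measurable_noise n).aestronglyMeasurable).2 (h.integrable_sq n)
      condExp_eq_zero := h.zero_mean }
  second_moment := h.second_moment
  update := h.update

end IsSecondMomentRun

end SemidefiniteGame

theorem mainTheorem6_general {N : ℕ} (G : SemidefiniteGame N) (Xs : Profile G.M)
    (hNash : G.IsNash Xs) (hD : G.HessianNegDef Xs) :
    ∃ U : Set (Profile G.M), IsOpen U ∧ Xs ∈ U ∧ ∀ σ : ℝ, ∀ ε > 0, ∃ δ : ℝ, 0 < δ ∧
      ∀ γ : ℕ → ℝ, (∀ n, 0 < γ n) → ¬ Summable γ → (Summable fun n => γ n ^ 2) →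
        ∑' n, γ n ^ 2 ≤ δ →
      ∀ (Ω : Type*) [MeasurableSpace Ω] (P : Measure Ω) [IsFiniteMeasure P]
        (Y Z : ℕ → Ω → Profile G.M), G.IsSecondMomentRun P γ σ Y Z →
        P {ω | G.choice (Y 0 ω) ∈ U} ≠ 0 →
        1 - ε ≤ (ProbabilityTheory.cond P {ω | G.choice (Y 0 ω) ∈ U}).real
          {ω | Tendsto (fun n => G.choice (Y n ω)) atTop (𝓝 Xs)} := by
  obtain ⟨κ, c, C, R, hG⟩ := SemidefiniteGame.exists_isDualAveraging hNash hD
  obtain ⟨r, hr, hconv⟩ := hG.exists_forall_le_cond_tendsto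
  have hopen : IsOpen {X : Profile G.M | ‖X - Xs‖ < r} :=
    isOpen_lt (by fun_prop) continuous_const
  refine ⟨{X | ‖X - Xs‖ < r}, hopen, by simpa using hr, fun σ ε hε => ?_⟩
  obtain ⟨δ, hδ, hδconv⟩ := hconv σ ε hε
  exact ⟨δ, hδ, fun γ hγ hsum hsq hle Ω _ P _ Y Z hrun hP =>
    hδconv γ hγ hsum hsq hle Ω P hrun.filtration Y Z (hrun.isStochasticRun hγ)
      (G.measurableSet_history Y 0 hopen) hP⟩

theorem mainTheorem6 {N : ℕ} (G : SemidefiniteGame N) (Xs : Profile G.M)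
    (hNash : G.IsNash Xs) (hD : G.HessianNegDef Xs)
    (σ : ℝ) (hσ : 0 < σ) (ε : ℝ) (hε : 0 < ε) :
    ∃ U : Set (Profile G.M), IsOpen U ∧ Xs ∈ U ∧ ∃ δ : ℝ, 0 < δ ∧
      ∀ γ : ℕ → ℝ, (∀ n, 0 < γ n) → ¬ Summable γ →
        (∃ q : ℝ, 0 < q ∧ q < 1 ∧ Summable fun n => γ n ^ (1 + q)) →
        ∑' n, γ n ^ 2 ≤ δ →
      ∀ (Ω : Type*) [MeasurableSpace Ω] (P : Measure Ω) [IsProbabilityMeasure P]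
        (Y Z : ℕ → Ω → Profile G.M), G.IsMXLRun P γ σ Y Z →
        P {ω | G.choice (Y 0 ω) ∈ U} ≠ 0 →
        1 - ε ≤ (ProbabilityTheory.cond P {ω | G.choice (Y 0 ω) ∈ U}).real
          {ω | Tendsto (fun n => G.choice (Y n ω)) atTop (𝓝 Xs)} := by
  obtain ⟨U, hU, hXs, hconv⟩ := mainTheorem6_general G Xs hNash hD
  obtain ⟨δ, hδ, hδconv⟩ := hconv σ ε hε
  exact ⟨U, hU, hXs, δ, hδ, fun γ hγ hsum ⟨_, hq0, hq1, hs⟩ hle Ω _ P _ Y Z hrun =>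
    hδconv γ hγ hsum (summable_sq_of_summable_rpow hγ (by linarith) (by linarith) hs) hle Ω P Y Z
      hrun.isSecondMomentRun⟩
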